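/- **Setting.** Let $\mathcal X$ be a set of prompts, $\mathcal B$ a countable set of blocks, $H$ the number of blocks of a full response, $\beta>0$, and $r(x,y)\in\mathbb R$ a reward for prompts $x$ and full responses $y=(y_1,\dots,y_H)$. A policy $\pi$ gives, for each prompt $x$ and each partial trace $y_{\le t}$ of blocks, a distribution $\pi(\cdot\mid x,y_{\le t})$ of the next block, and so a law $\pi(\cdot\mid x)$ of full responses. Let $\pi_{\rm target},\pi_{\rm draft}$ be policies. The optimal policy is $\pi^\star_\beta(y\mid x)\propto \pi_{\rm target}(y\mid x)e^{\beta r(x,y)}$. The value is $V_\beta(x,y_{\le t})=\frac1\beta\log\mathbb E_{Y\sim\pi_{\rm target}(\cdot\mid x,y_{\le t})}[e^{\beta r(x,Y)}]$ with $Y$ a completion of $y_{\le t}$ to a full response, and the idealized process reward model (PRM) is $$r_{\rm PRM}(y_t\mid x,y_{\le t-1})=V_\beta(x,y_{\le t})-V_\beta(x,y_{\le t-1}).$$ **Algorithm (SPECS, with a threshold $\tau\in\mathbb R$ and Poissonized beam width $n$).** Start from the empty trace with generator $\pi_{\rm gen}=\pi_{\rm target}$. Repeat $H$ times, with current trace $y_{<t}$: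 draw $N\sim\mathrm{Poi}(n)$ conditioned on $N>0$; draw $Y_1,\dots,Y_N$ i.i.d. from $\pi_{\rm gen}(\cdot\mid x,y_{<t})$; append $Y_{i^\star}$ to the trace, where $\Pr(i^\star=i)\propto e^{S_i}$ and $S_i=\log\frac{\pi_{\rm target}(Y_i\mid x,y_{<t})}{\pi_{\rm gen}(Y_i\mid x,y_{<t})}+\beta\, r_{\rm PRM}(Y_i\mid x,y_{<t})$; if $\max_i r_{\rm PRM}(Y_i\mid x,y_{<t})>\tau$, set $\pi_{\rm gen}\leftarrow\pi_{\rm draft}$ for all later iterations. Let $\pi_{\rm SPECS}(\cdot\mid x)$ be the law of the resulting full response. **Theorem.** There are universal constants $c>0$ and $k\in\mathbb N$ such that the following holds for all such data and all integers $n\ge 3$. Assume that the PRM has range $[0,R]$ up to a baseline: for some function $b(x,y_{<t})$, $\;b(x,y_{<t})\le r_{\rm PRM}(y_t\mid x,y_{<t})\le b(x,y_{<t})+R$ for all $x$, all $t\le H$ and all blocks $y_1,\dots,y_t$. (This holds in particular when the rewards satisfy $0\le r\le R$, with $b=-V_\beta$, and when $0\le r_{\rm PRM}\le R$, with $b=0$.)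 Let $$C_{\rm block}(x)=\sup_{0\le t<H}\ \sup_{y_{\le t}}\left\|\frac{\pi_{\rm target}(\cdot\mid x,y_{\le t})}{\pi_{\rm draft}(\cdot\mid x,y_{\le t})}\right\|_\infty\left\|\frac{\pi_{\rm draft}(\cdot\mid x,y_{\le t})}{\pi_{\rm target}(\cdot\mid x,y_{\le t})}\right\|_\infty\in[0,\infty]$$ (with $0/0=0$ and $a/0=\infty$ for $a>0$). Then for every prompt $x$ $$D_{\rm KL}\big(\pi_{\rm SPECS}(\cdot\mid x)\,\big\|\,\pi^\star_\beta(\cdot\mid x)\big)\ \le\ c\,(\log n)^k\; H\, C_{\rm block}(x)^2\,\frac{e^{2\beta R}}{n^{3/2}},$$ and consequently, for every (discrete) prompt distribution $\rho$ and $C_{\rm block}=\sup_x C_{\rm block}(x)$, $$D_{\rm KL}(\pi_{\rm SPECS}\|\pi^\star_\beta)=\mathbb E_{x\sim\rho}\big[D_{\rm KL}(\pi_{\rm SPECS}(\cdot\mid x)\|\pi^\star_\beta(\cdot\mid x))\big]\ \le\ c\,(\log n)^k\; H\, C_{\rm block}^2\,\frac{e^{2\beta R}}{n^{3/2}}.$$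 -/

import Mathlib

open scoped NNReal ENNReal
open MeasureTheory ProbabilityTheory

namespace SPECS

noncomputable section

/-- Block sequences (partial traces and responses) form a discrete space. -/
instance instMeasurableSpaceTrace (B : Type*) : MeasurableSpace (List B) := ⊤

/-- A (language-model) policy: for every prompt `x : X` and every partial trace of blocks, the
distribution of the next block. -/
abbrev Policy (X B : Type*) := X → List B → PMF B

/-- The law of the trace obtained from `tr` by drawing `k` further blocks autoregressively. -/
def complete {X B : Type*} (π : Policy X B) (x : X) : ℕ → List B → PMF (List B)
  | 0, tr => PMF.pure tr
  | k + 1, tr => (π x tr).bind fun b => complete π x k (tr ++ [b])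

/-- The law `π(· | x)` of full responses (`H` blocks) of the policy `π`. -/
def responseLaw {X B : Type*} (π : Policy X B) (H : ℕ) (x : X) : PMF (List B) :=
  complete π x H []

/-- The optimal KL-regularized value
`V_β^π(x, y_{≤t}) = β⁻¹ log E[exp (β r(x, Y))]`, where `Y` completes `tr = y_{≤t}` under `π` to a
full response of `H` blocks (used for `tr.length ≤ H`). -/
def value {X B : Type*} (π : Policy X B) (H : ℕ) (β : ℝ) (r : X → List B → ℝ)
    (x : X) (tr : List B) : ℝ :=
  (1 / β) * Real.log
    (∑' y : List B, (complete π x (H - tr.length) tr y).toReal * Real.exp (β * r x y))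

/-- The idealized process reward model: the KL-regularized advantage
`r_PRM^π(y_t | x, y_{≤t-1}) = V_β^π(x, y_{≤t}) - V_β^π(x, y_{≤t-1})`. -/
def prm {X B : Type*} (π : Policy X B) (H : ℕ) (β : ℝ) (r : X → List B → ℝ)
    (x : X) (tr : List B) (b : B) : ℝ :=
  value π H β r x (tr ++ [b]) - value π H β r x tr

/-- The optimal aligned policy over full responses,
`π*_β(y | x) ∝ π_target(y | x) exp (β r(x, y))`. -/
def optimalLaw {X B : Type*} (target : Policy X B) (H : ℕ) (β : ℝ) (r : X → List B → ℝ)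
    (x : X) : Measure (List B) :=
  (responseLaw target H x).toMeasure.tilted fun y => β * r x y

/-- The exponentiated score `e^S` of a block `b`, with
`S = log (π_target(b | tr) / π_gen(b | tr)) + β r(b | tr)`; here `p` and `g` are the next-block
distributions of the target and of the generator and `s` is the process reward. -/
def expScore {B : Type*} (p g : PMF B) (β : ℝ) (s : B → ℝ) (b : B) : ℝ≥0∞ :=
  p b / g b * ENNReal.ofReal (Real.exp (β * s b))

/-- `N` i.i.d. draws from `g`. -/
def iidDraws {B : Type*} (g : PMF B) : ℕ → PMF (List B)
  | 0 => PMF.pure []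
  | N + 1 => g.bind fun b => (iidDraws g N).map fun Ys => b :: Ys

open Classical in
/-- The subsampling routine: from the candidates `Ys`, return `Ys i` with probability proportional
to `w (Ys i) = e^{S_i}`. If the weights cannot be normalized (all of them vanish, or there is no
candidate) a fresh draw of the generator `g` is returned; this has probability zero whenever the
target and draft models have the same supports and there is at least one candidate. -/
def subSample {B : Type*} (g : PMF B) (w : B → ℝ≥0∞) (Ys : List B) : PMF B :=
  if h : (∑' i : Fin Ys.length, w (Ys.get i)) ≠ 0 ∧ (∑' i : Fin Ys.length, w (Ys.get i)) ≠ ∞ then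
    (PMF.normalize (fun i : Fin Ys.length => w (Ys.get i)) h.1 h.2).map Ys.get
  else g

/-- Which of the two models currently generates the candidates. -/
inductive Generator
  | target
  | draft

/-- The model that `gen` refers to. -/
def Generator.policy {X B : Type*} (target draft : Policy X B) : Generator → Policy X B
  | .target => target
  | .draft => draft

open Classical in
/-- One iteration of the algorithm in state (partial trace, current generator): the number of
candidates is drawn from `beam`, the candidates are drawn i.i.d. from the generator, one of them is
selected by `subSample` and appended, and the generator becomes the draft model if the largest
process reward among the candidates exceeds the threshold `τ`. -/
def step {X B : Type*} (target draft : Policy X B) (β : ℝ) (s : X → List B → B → ℝ) (τ : ℝ)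
    (beam : PMF ℕ) (x : X) (st : List B × Generator) : PMF (List B × Generator) :=
  let g : PMF B := st.2.policy target draft x st.1
  beam.bind fun N =>
    (iidDraws g N).bind fun Ys =>
      (subSample g (expScore (target x st.1) g β (s x st.1)) Ys).map fun b =>
        (st.1 ++ [b], if ∃ c ∈ Ys, τ < s x st.1 c then Generator.draft else st.2)

/-- `k` iterations of the algorithm. -/
def run {X B : Type*} (target draft : Policy X B) (β : ℝ) (s : X → List B → B → ℝ) (τ : ℝ)
    (beam : PMF ℕ) (x : X) : ℕ → List B × Generator → PMF (List B × Generator)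
  | 0, st => PMF.pure st
  | k + 1, st => (step target draft β s τ beam x st).bind (run target draft β s τ beam x k)

/-- The policy returned by SPECS with process reward model `s`: the law of the response after `H`
blocks, starting with the target model as generator. -/
def specsLaw {X B : Type*} (target draft : Policy X B) (H : ℕ) (β : ℝ)
    (s : X → List B → B → ℝ) (τ : ℝ) (beam : PMF ℕ) (x : X) : PMF (List B) :=
  (run target draft β s τ beam x H ([], Generator.target)).map Prod.fst

theorem exists_pos_mem_support_poisson (n : ℕ) (hn : 0 < n) :
    ∃ a ∈ {N : ℕ | 0 < N}, a ∈ (poissonMeasure (n : ℝ≥0)).toPMF.support := by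
  refine ⟨1, by simp, ?_⟩
  rw [PMF.mem_support_iff, Measure.toPMF_apply, poissonMeasure_singleton]
  have : (0 : ℝ) < n := by exact_mod_cast hn
  simp only [ne_eq, ENNReal.ofReal_eq_zero, not_le]
  positivity

/-- The Poissonized beam width `Poi(n)|_{>0}`: a Poisson variable of mean `n` conditioned on being
positive. -/
def poissonBeam (n : ℕ) (hn : 0 < n) : PMF ℕ :=
  (poissonMeasure (n : ℝ≥0)).toPMF.filter {N : ℕ | 0 < N} (exists_pos_mem_support_poisson n hn)

/-- The block-level coverage coefficient at the prompt `x`,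
`sup_{y_{≤t}} ‖π_target(· | x, y_{≤t}) / π_draft(· | x, y_{≤t})‖_∞ ·
‖π_draft(· | x, y_{≤t}) / π_target(· | x, y_{≤t})‖_∞`, over the traces that still have a next block.
In `ℝ≥0∞` one has `0 / 0 = 0` and `a / 0 = ∞` for `a ≠ 0`. -/
def blockCoverage {X B : Type*} (target draft : Policy X B) (H : ℕ) (x : X) : ℝ≥0∞ :=
  ⨆ (tr : List B) (_ : tr.length < H),
    (⨆ b : B, target x tr b / draft x tr b) * (⨆ b : B, draft x tr b / target x tr b)

/-- The process reward model `s` has range `[0, R]`, up to a baseline that depends only on the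
prompt and the partial trace. -/
def HasRange {X B : Type*} (s : X → List B → B → ℝ) (H : ℕ) (R : ℝ) : Prop :=
  ∃ base : X → List B → ℝ, ∀ (x : X) (tr : List B), tr.length < H → ∀ b : B,
    base x tr ≤ s x tr b ∧ s x tr b ≤ base x tr + R

end

end SPECS

/-! Since `exp (β * prm)` is a ratio of successive partition functions, tilting the target's
next-block law by it gives a probability law `Q`, and along a trace the ratios telescope. Hence the
optimal law is autoregressive with next-block laws `Q` (`complete_mul_partition`, `optimalLaw_eq`).
Each iteration is then importance resampling towards `Q` from a generator `g`, with weights `w = Q /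
g`. For either model as generator these lie in `[1/M, M]` on the support of `g`, where `M = C_block
* exp (β R)` (`expScore_bounds`).

Exchangeability and the Poisson identity `(N+1) P(N+1) = n P(N)` show that the selected block has
density `D b = n / (1 - exp (-n)) * E[1 / (w b + S)]` relative to `Q`, where `S` is a compound
Poisson sum of mean `n` (`expect_blockLaw`). The density `D` has `Q`-mean one. It oscillates by at
most `2 n M E[(1/M + S)⁻²]`, which is of order `M / n` up to a Chernoff term for the event `S < n/4`
(`blockDensity_le_add`). If `M ^ 4 ≤ n ^ 3`, bounding entropy by chi-square gives order `M ^ 2 / n ^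
2`. Otherwise `D ≤ M ^ 2` gives the entropy bound `log (M ^ 2)`, which suffices because then `M ^ 2
≥ n ^ (3/2)` (`min_entropy_le`).

The chain rule adds up the `H` iterations (`entropyLe_run`). Entropy is handled in Donsker-Varadhan
form, so that only the trace is tested; the one-step bound is uniform in the generator, so the
switching rule and `τ` play no role. -/

namespace SPECS

noncomputable section

/-! ### Expectations under probability mass functions -/

/-- The expectation of an extended nonnegative function under a probability mass function. -/
def expect {α : Type*} (p : PMF α) (f : α → ℝ≥0∞) : ℝ≥0∞ := ∑' a, p a * f a

section Expect

variable {α γ : Type*}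

theorem expect_bind (p : PMF α) (q : α → PMF γ) (f : γ → ℝ≥0∞) :
    expect (p.bind q) f = expect p fun a => expect (q a) f := by
  simp only [expect, PMF.bind_apply, ← ENNReal.tsum_mul_right, ← ENNReal.tsum_mul_left]
  rw [ENNReal.tsum_comm]
  simp only [mul_assoc]

theorem expect_pure (a : α) (f : α → ℝ≥0∞) : expect (PMF.pure a) f = f a := by
  classical
  rw [expect, tsum_eq_single a]
  · simp
  · intro b hb
    simp [PMF.pure_apply, hb]

theorem expect_map (p : PMF α) (h : α → γ) (f : γ → ℝ≥0∞) :
    expect (p.map h) f = expect p fun a => f (h a) := by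
  rw [PMF.map, expect_bind]
  simp only [Function.comp, expect_pure]

theorem expect_const (p : PMF α) (c : ℝ≥0∞) : expect p (fun _ => c) = c := by
  rw [expect, ENNReal.tsum_mul_right, p.tsum_coe, one_mul]

theorem expect_add (p : PMF α) (f h : α → ℝ≥0∞) :
    (expect p fun a => f a + h a) = expect p f + expect p h := by
  simp only [expect, mul_add, ENNReal.tsum_add]

theorem expect_const_mul (p : PMF α) (c : ℝ≥0∞) (f : α → ℝ≥0∞) :
    (expect p fun a => c * f a) = c * expect p f := by
  simp only [expect, ← ENNReal.tsum_mul_left, mul_left_comm]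

theorem expect_mono_of_support {p : PMF α} {f h : α → ℝ≥0∞} (H : ∀ a ∈ p.support, f a ≤ h a) :
    expect p f ≤ expect p h := by
  refine ENNReal.tsum_le_tsum fun a => ?_
  by_cases ha : p a = 0
  · simp [ha]
  · exact mul_le_mul_right (H a ((p.mem_support_iff a).2 ha)) _

theorem expect_congr_of_support {p : PMF α} {f h : α → ℝ≥0∞} (H : ∀ a ∈ p.support, f a = h a) :
    expect p f = expect p h :=
  le_antisymm (expect_mono_of_support fun a ha => (H a ha).le)
    (expect_mono_of_support fun a ha => (H a ha).ge)

theorem expect_indicator [DecidableEq α] (p : PMF α) (a : α) :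
    (expect p fun c => if c = a then 1 else 0) = p a := by
  rw [expect, tsum_eq_single a]
  · simp
  · intro b hb
    simp [hb]

theorem pmf_summable_toReal (p : PMF α) : Summable fun a => (p a).toReal :=
  ENNReal.summable_toReal p.tsum_coe_ne_top

theorem pmf_hasSum_toReal (p : PMF α) : HasSum (fun a => (p a).toReal) 1 := by
  have h := (pmf_summable_toReal p).hasSum
  rwa [← ENNReal.tsum_toReal_eq p.apply_ne_top, p.tsum_coe, ENNReal.toReal_one] at h

theorem pmf_summable_toReal_mul (p : PMF α) {f : α → ℝ} {C : ℝ} (hf : ∀ a, |f a| ≤ C) :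
    Summable fun a => (p a).toReal * f a := by
  refine Summable.of_norm_bounded ((pmf_summable_toReal p).mul_right C) fun a => ?_
  rw [Real.norm_eq_abs, abs_mul, abs_of_nonneg ENNReal.toReal_nonneg]
  exact mul_le_mul_of_nonneg_left (hf a) ENNReal.toReal_nonneg

theorem expect_ofReal (p : PMF α) {f : α → ℝ} (hf : ∀ a, 0 ≤ f a)
    (hs : Summable fun a => (p a).toReal * f a) :
    (expect p fun a => ENNReal.ofReal (f a)) = ENNReal.ofReal (∑' a, (p a).toReal * f a) := by
  rw [ENNReal.ofReal_tsum_of_nonneg (fun a => mul_nonneg ENNReal.toReal_nonneg (hf a)) hs]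
  refine tsum_congr fun a => ?_
  rw [ENNReal.ofReal_mul ENNReal.toReal_nonneg, ENNReal.ofReal_toReal (p.apply_ne_top a)]

end Expect

/-! ### A variational bound on the relative entropy -/

/-- The logarithm of an extended nonnegative number, truncated below at zero. -/
def posLog (u : ℝ≥0∞) : ℝ≥0∞ := ENNReal.ofReal (Real.log u.toReal)

/-- The Donsker-Varadhan form of the bound `KL(P ‖ Q) ≤ K`. -/
def EntropyLe {α : Type*} (P Q : PMF α) (K : ℝ≥0∞) : Prop :=
  ∀ (u : α → ℝ≥0∞) (L : ℝ≥0∞), L ≠ ∞ → (∀ a, 1 ≤ u a) → (∀ a, u a ≤ L) →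
    (expect P fun a => posLog (u a)) ≤ K + posLog (expect Q u)

section Entropy

variable {α : Type*}

theorem entropyLe_self_pure (a : α) : EntropyLe (PMF.pure a) (PMF.pure a) 0 := by
  intro u L _ _ _
  simp [expect_pure]

/-- The term `c * (ρ - 1)` has `Q`-mean zero, so `c` may be chosen freely to make the pointwise
bound hold. -/
theorem entropyLe_of_density {P Q : PMF α} {ρ : α → ℝ} {K c : ℝ} (hρ0 : ∀ a, 0 ≤ ρ a)
    (hPQ : ∀ a, P a = Q a * ENNReal.ofReal (ρ a))
    (hρ : ∀ a ∈ Q.support, ρ a * Real.log (ρ a) ≤ K + c * (ρ a - 1)) :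
    EntropyLe P Q (ENNReal.ofReal K) := by
  intro u L hL h1 h2
  have hL1 : ∀ a, (u a).toReal ≤ L.toReal := fun a => ENNReal.toReal_mono hL (h2 a)
  have hu : ∀ a, u a ≠ ∞ := fun a => ne_top_of_le_ne_top hL (h2 a)
  have hu1 : ∀ a, 1 ≤ (u a).toReal := fun a => by
    simpa using ENNReal.toReal_mono (hu a) (h1 a)
  have hPr : ∀ a, (P a).toReal = (Q a).toReal * ρ a := fun a => by
    rw [hPQ, ENNReal.toReal_mul, ENNReal.toReal_ofReal (hρ0 a)]
  have hQu : Summable fun a => (Q a).toReal * (u a).toReal :=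
    pmf_summable_toReal_mul Q (C := L.toReal) fun a => by
      rw [abs_of_nonneg ENNReal.toReal_nonneg]; exact hL1 a
  set v : ℝ := ∑' a, (Q a).toReal * (u a).toReal with hv
  have hexp : expect Q u = ENNReal.ofReal v := by
    rw [hv, ← expect_ofReal Q (fun a => ENNReal.toReal_nonneg) hQu]
    simp only [ENNReal.ofReal_toReal (hu _)]
  have hv1 : 1 ≤ v := by
    rw [← (pmf_hasSum_toReal Q).tsum_eq]
    refine (pmf_summable_toReal Q).tsum_le_tsum (fun a => ?_) hQu
    exact le_mul_of_one_le_right ENNReal.toReal_nonneg (hu1 a)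
  have hv0 : 0 < v := by linarith
  have hlog : ∀ a, 0 ≤ Real.log (u a).toReal := fun a => Real.log_nonneg (hu1 a)
  have hPl : Summable fun a => (P a).toReal * Real.log (u a).toReal :=
    pmf_summable_toReal_mul P (C := Real.log L.toReal) fun a => by
      rw [abs_of_nonneg (hlog a)]
      exact Real.log_le_log (by linarith [hu1 a]) (hL1 a)
  have key : ∀ a, (P a).toReal * Real.log (u a).toReal ≤
      (P a).toReal * (Real.log v - 1 + c) + (Q a).toReal * (u a).toReal * v⁻¹
        + (Q a).toReal * (K - c) := by
    intro a
    by_cases hq : Q a = 0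
    · simp [hPr, hq]
    have hb := hρ a ((Q.mem_support_iff a).2 hq)
    have h3 : ρ a * Real.log (u a).toReal ≤
        ρ a * (Real.log v - 1 + c) + (u a).toReal * v⁻¹ + (K - c) := by
      rcases (hρ0 a).eq_or_lt with h0 | h0
      · rw [← h0] at hb ⊢
        have : 0 ≤ (u a).toReal * v⁻¹ := by positivity
        simp at hb ⊢
        linarith
      · have hua : 0 < (u a).toReal := by linarith [hu1 a]
        -- This is the pointwise form of Donsker-Varadhan: `u / v` is itself a density relative to
        -- `Q`, compared here with `ρ`.
        have h4 := Real.log_le_sub_one_of_pos (x := (u a).toReal * v⁻¹ / ρ a) (by positivity)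
        rw [Real.log_div (by positivity) h0.ne', Real.log_mul hua.ne' (by positivity),
          Real.log_inv] at h4
        have h5 := mul_le_mul_of_nonneg_left h4 h0.le
        have h6 : ρ a * ((u a).toReal * v⁻¹ / ρ a - 1) = (u a).toReal * v⁻¹ - ρ a := by
          field_simp
        rw [h6] at h5
        linarith
    have h7 := mul_le_mul_of_nonneg_left h3 (ENNReal.toReal_nonneg (a := Q a))
    rw [hPr]
    linarith
  have hsum : (∑' a, (P a).toReal * Real.log (u a).toReal) ≤ K + Real.log v := by
    have hS := (((pmf_hasSum_toReal P).mul_right (Real.log v - 1 + c)).add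
      (hQu.hasSum.mul_right v⁻¹)).add ((pmf_hasSum_toReal Q).mul_right (K - c))
    refine (hPl.tsum_le_tsum key hS.summable).trans (hS.tsum_eq.le.trans ?_)
    rw [← hv, mul_inv_cancel₀ hv0.ne']
    linarith
  simp only [posLog]
  rw [expect_ofReal P hlog hPl, hexp, ENNReal.toReal_ofReal hv0.le]
  exact (ENNReal.ofReal_le_ofReal hsum).trans ENNReal.ofReal_add_le

/-- Dividing the test function by `lo` makes it at least one; the resulting shift by `log lo` is the
same on both sides. -/
theorem EntropyLe.tsum_log_le {P Q : PMF α} {κ : ℝ} (hκ : 0 ≤ κ)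
    (h : EntropyLe P Q (ENNReal.ofReal κ)) {t : α → ℝ} {lo hi : ℝ} (hlo : 0 < lo)
    (h1 : ∀ a, lo ≤ t a) (h2 : ∀ a, t a ≤ hi) :
    (∑' a, (P a).toReal * Real.log (t a)) ≤ κ + Real.log (∑' a, (Q a).toReal * t a) := by
  have ht0 : ∀ a, 0 < t a := fun a => hlo.trans_le (h1 a)
  have hone : ∀ a, 1 ≤ t a / lo := fun a => (one_le_div hlo).2 (h1 a)
  have hQt : Summable fun a => (Q a).toReal * t a :=
    pmf_summable_toReal_mul Q (C := hi) fun a => by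
      rw [abs_of_pos (ht0 a)]; exact h2 a
  have hQt' : Summable fun a => (Q a).toReal * (t a / lo) := by
    simpa only [mul_div_assoc] using hQt.div_const lo
  have hlog0 : ∀ a, 0 ≤ Real.log (t a / lo) := fun a => Real.log_nonneg (hone a)
  have hPl : Summable fun a => (P a).toReal * Real.log (t a / lo) :=
    pmf_summable_toReal_mul P (C := Real.log (hi / lo)) fun a => by
      rw [abs_of_nonneg (hlog0 a)]
      exact Real.log_le_log (by linarith [hone a]) (by gcongr; exact h2 a)
  have hv : lo ≤ ∑' a, (Q a).toReal * t a := by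
    have := (pmf_hasSum_toReal Q).mul_right lo
    rw [one_mul] at this
    rw [← this.tsum_eq]
    exact this.summable.tsum_le_tsum
      (fun a => mul_le_mul_of_nonneg_left (h1 a) ENNReal.toReal_nonneg) hQt
  have hv0 := hlo.trans_le hv
  have hdv := h (fun a => ENNReal.ofReal (t a / lo)) (ENNReal.ofReal (hi / lo))
    ENNReal.ofReal_ne_top (fun a => by rw [ENNReal.one_le_ofReal]; exact hone a)
    (fun a => ENNReal.ofReal_le_ofReal (by gcongr; exact h2 a))
  simp only [posLog] at hdv
  rw [expect_ofReal Q (fun a => by linarith [hone a]) hQt'] at hdv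
  have hrw : ∀ a, (ENNReal.ofReal (t a / lo)).toReal = t a / lo := fun a =>
    ENNReal.toReal_ofReal (by linarith [hone a])
  have hdiv : (∑' a, (Q a).toReal * (t a / lo)) = (∑' a, (Q a).toReal * t a) / lo := by
    simp only [← mul_div_assoc, tsum_div_const]
  simp only [hrw] at hdv
  rw [expect_ofReal P hlog0 hPl, hdiv,
    ENNReal.toReal_ofReal (by positivity),
    ← ENNReal.ofReal_add hκ (Real.log_nonneg ((one_le_div hlo).2 hv)),
    ENNReal.ofReal_le_ofReal_iff (add_nonneg hκ (Real.log_nonneg ((one_le_div hlo).2 hv))),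
    Real.log_div hv0.ne' hlo.ne'] at hdv
  have hsplit : ∀ a, (P a).toReal * Real.log (t a) =
      (P a).toReal * Real.log (t a / lo) + (P a).toReal * Real.log lo := fun a => by
    rw [Real.log_div (ht0 a).ne' hlo.ne']; ring
  have hS := hPl.hasSum.add ((pmf_hasSum_toReal P).mul_right (Real.log lo))
  simp only [hsplit]
  rw [hS.tsum_eq]
  linarith

/-- A linearized form, from `log (1 + z) ≤ z`, whose test functions differ from one only on a finite
set. -/
theorem EntropyLe.sum_log_le {P Q : PMF α} {κ : ℝ} (hκ : 0 ≤ κ)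
    (h : EntropyLe P Q (ENNReal.ofReal κ)) (F : Finset α) {t : α → ℝ} (ht : ∀ a, 0 < t a)
    (htF : ∀ a ∉ F, t a = 1) :
    ∑ a ∈ F, (P a).toReal * Real.log (t a) ≤ κ + ∑ a ∈ F, (Q a).toReal * (t a - 1) := by
  have hbd : ∀ f : α → ℝ, (∀ a, 0 < f a) → (∀ a ∉ F, f a = 1) → ∀ a, f a ≤ 1 + ∑ b ∈ F, f b := by
    intro f hf hfF a
    by_cases ha : a ∈ F
    · have := Finset.single_le_sum (f := f) (fun b _ => (hf b).le) ha
      linarith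
    · rw [hfF a ha]
      have := Finset.sum_nonneg (s := F) fun b _ => (hf b).le
      linarith
  have hlow := hbd (fun a => (t a)⁻¹) (fun a => inv_pos.2 (ht a))
    (fun a ha => by simp [htF a ha])
  have hpos : 0 < 1 + ∑ b ∈ F, (t b)⁻¹ := by
    have := Finset.sum_nonneg (s := F) fun b _ => (inv_pos.2 (ht b)).le
    linarith
  have hdv := h.tsum_log_le hκ (inv_pos.2 hpos)
    (fun a => (inv_le_comm₀ hpos (ht a)).2 (hlow a)) (hbd t ht htF)
  have e1 : (∑' a, (P a).toReal * Real.log (t a)) = ∑ a ∈ F, (P a).toReal * Real.log (t a) :=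
    tsum_eq_sum fun a ha => by simp [htF a ha]
  have e2 : HasSum (fun a => (Q a).toReal * (t a - 1)) (∑ a ∈ F, (Q a).toReal * (t a - 1)) :=
    hasSum_sum_of_ne_finset_zero fun a ha => by simp [htF a ha]
  have e3 := e2.add (pmf_hasSum_toReal Q)
  have e4 : (fun a => (Q a).toReal * (t a - 1) + (Q a).toReal) = fun a => (Q a).toReal * t a := by
    funext a; ring
  rw [e4] at e3
  rw [e1, e3.tsum_eq] at hdv
  have hvpos : 0 < ∑ a ∈ F, (Q a).toReal * (t a - 1) + 1 := by
    rw [← e3.tsum_eq]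
    have hle : ∀ a, (Q a).toReal * (1 + ∑ b ∈ F, (t b)⁻¹)⁻¹ ≤ (Q a).toReal * t a := fun a =>
      mul_le_mul_of_nonneg_left ((inv_le_comm₀ hpos (ht a)).2 (hlow a)) ENNReal.toReal_nonneg
    have hs := (pmf_hasSum_toReal Q).mul_right (1 + ∑ b ∈ F, (t b)⁻¹)⁻¹
    have := hs.summable.tsum_le_tsum hle e3.summable
    rw [hs.tsum_eq, one_mul] at this
    exact (inv_pos.2 hpos).trans_le this
  have := Real.log_le_sub_one_of_pos hvpos
  linarith

theorem EntropyLe.apply_eq_zero {P Q : PMF α} {κ : ℝ} (hκ : 0 ≤ κ)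
    (h : EntropyLe P Q (ENNReal.ofReal κ)) {y : α} (hy : Q y = 0) : P y = 0 := by
  classical
  by_contra hP
  have hp : 0 < (P y).toReal := ENNReal.toReal_pos hP (P.apply_ne_top y)
  -- The height of the spike at `y` is chosen to produce the contradiction `κ + 1 ≤ κ`.
  have := h.sum_log_le hκ {y} (t := fun a => if a = y then Real.exp ((κ + 1) / (P y).toReal) else 1)
    (fun a => by split_ifs <;> positivity) (fun a ha => by simp at ha; simp [ha])
  simp only [Finset.sum_singleton, if_true, Real.log_exp, hy, ENNReal.toReal_zero, zero_mul] at this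
  rw [mul_div_cancel₀ _ hp.ne'] at this
  linarith

theorem EntropyLe.sum_klFun_le {P Q : PMF α} {κ : ℝ} (hκ : 0 ≤ κ)
    (h : EntropyLe P Q (ENNReal.ofReal κ)) (F : Finset α) :
    ∑ a ∈ F, (Q a).toReal * InformationTheory.klFun ((P a).toReal / (Q a).toReal) ≤ κ := by
  classical
  refine le_of_forall_pos_le_add fun δ hδ => ?_
  -- The optimal test function is `P / Q`. Where `P` vanishes it is replaced by `δ` to stay
  -- positive, at a total cost of at most `δ`.
  have hbase := h.sum_log_le hκ F
    (t := fun a => if a ∈ F ∧ Q a ≠ 0 then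
      (if P a = 0 then δ else (P a).toReal / (Q a).toReal) else 1)
    (fun a => by
      split_ifs with h1 h2
      · exact hδ
      · exact div_pos (ENNReal.toReal_pos h2 (P.apply_ne_top a))
          (ENNReal.toReal_pos h1.2 (Q.apply_ne_top a))
      · exact one_pos)
    (fun a ha => by simp [ha])
  have hQF : ∑ a ∈ F, (Q a).toReal ≤ 1 :=
    sum_le_hasSum F (fun a _ => ENNReal.toReal_nonneg) (pmf_hasSum_toReal Q)
  have hpt : ∀ a ∈ F, (Q a).toReal * InformationTheory.klFun ((P a).toReal / (Q a).toReal) ≤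
      (P a).toReal * Real.log (if a ∈ F ∧ Q a ≠ 0 then
        (if P a = 0 then δ else (P a).toReal / (Q a).toReal) else 1)
      - (Q a).toReal * ((if a ∈ F ∧ Q a ≠ 0 then
        (if P a = 0 then δ else (P a).toReal / (Q a).toReal) else 1) - 1)
      + δ * (Q a).toReal := by
    intro a ha
    by_cases hq : Q a = 0
    · simp [hq]
    · by_cases hp : P a = 0
      · simp only [hp, ha, InformationTheory.klFun, ENNReal.toReal_zero]
        simp [hq]
        linarith
      · have hq' : 0 < (Q a).toReal := ENNReal.toReal_pos hq (Q.apply_ne_top a)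
        simp only [hp, ha, hq, InformationTheory.klFun, ne_eq, not_false_eq_true, and_self, if_true,
          if_false]
        have : 0 ≤ δ * (Q a).toReal := by positivity
        have e : (Q a).toReal * ((P a).toReal / (Q a).toReal) = (P a).toReal := by field_simp
        have e2 : (Q a).toReal * ((P a).toReal / (Q a).toReal *
            Real.log ((P a).toReal / (Q a).toReal) + 1 - (P a).toReal / (Q a).toReal) =
            (P a).toReal * Real.log ((P a).toReal / (Q a).toReal) + (Q a).toReal
              - (P a).toReal := by
          rw [mul_sub, mul_add, ← mul_assoc, e, mul_one]
        rw [e2, mul_sub, e]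
        linarith
  refine (Finset.sum_le_sum hpt).trans ?_
  rw [Finset.sum_add_distrib, Finset.sum_sub_distrib, ← Finset.mul_sum]
  have : δ * ∑ a ∈ F, (Q a).toReal ≤ δ := by
    simpa using mul_le_mul_of_nonneg_left hQF hδ.le
  linarith

/-- Because `klFun` is nonnegative, the divergence is the supremum of its partial sums over finite
sets. -/
theorem EntropyLe.klDiv_le [Countable α] [MeasurableSpace α] [DiscreteMeasurableSpace α]
    {P Q : PMF α} {K : ℝ≥0∞} (h : EntropyLe P Q K) :
    InformationTheory.klDiv P.toMeasure Q.toMeasure ≤ K := by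
  by_cases hK : K = ∞
  · simp [hK]
  obtain ⟨κ, hκ, rfl⟩ : ∃ κ : ℝ, 0 ≤ κ ∧ K = ENNReal.ofReal κ :=
    ⟨K.toReal, ENNReal.toReal_nonneg, (ENNReal.ofReal_toReal hK).symm⟩
  have hsing : ∀ (p : PMF α) (a : α), p.toMeasure {a} = p a := fun p a =>
    p.toMeasure_apply_singleton a (MeasurableSet.of_discrete)
  have hdens : P.toMeasure = Q.toMeasure.withDensity fun a => P a / Q a := by
    refine Measure.ext_of_singleton fun a => ?_
    rw [withDensity_apply _ MeasurableSet.of_discrete, Measure.restrict_singleton,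
      lintegral_smul_measure, lintegral_dirac, hsing, hsing, smul_eq_mul]
    by_cases hq : Q a = 0
    · simp [hq, h.apply_eq_zero hκ hq]
    · rw [mul_comm, ENNReal.div_mul_cancel hq (Q.apply_ne_top a)]
  have hac : P.toMeasure ≪ Q.toMeasure := by
    rw [hdens]; exact withDensity_absolutelyContinuous _ _
  have hrn : P.toMeasure.rnDeriv Q.toMeasure =ᵐ[Q.toMeasure] fun a => P a / Q a := by
    conv_lhs => rw [hdens]
    exact Measure.rnDeriv_withDensity _ Measurable.of_discrete
  rw [InformationTheory.klDiv_eq_lintegral_klFun_of_ac hac]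
  have hcongr : (∫⁻ a, ENNReal.ofReal (InformationTheory.klFun
      (P.toMeasure.rnDeriv Q.toMeasure a).toReal) ∂Q.toMeasure) =
      ∫⁻ a, ENNReal.ofReal (InformationTheory.klFun (P a / Q a).toReal) ∂Q.toMeasure := by
    refine lintegral_congr_ae ?_
    filter_upwards [hrn] with a ha
    rw [ha]
  rw [hcongr, lintegral_countable', ENNReal.tsum_eq_iSup_sum]
  refine iSup_le fun F => ?_
  have hterm : ∀ a, ENNReal.ofReal (InformationTheory.klFun (P a / Q a).toReal) * Q.toMeasure {a} =
      ENNReal.ofReal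
        ((Q a).toReal * InformationTheory.klFun ((P a).toReal / (Q a).toReal)) := fun a => by
    rw [hsing, mul_comm, ENNReal.ofReal_mul ENNReal.toReal_nonneg,
      ENNReal.ofReal_toReal (Q.apply_ne_top a), ENNReal.toReal_div]
  simp only [hterm]
  rw [← ENNReal.ofReal_sum_of_nonneg fun a _ => mul_nonneg ENNReal.toReal_nonneg
    (InformationTheory.klFun_nonneg (by positivity))]
  exact ENNReal.ofReal_le_ofReal (h.sum_klFun_le hκ F)

end Entropy

/-! ### Independent draws -/

section Draws

variable {α γ B : Type*}

theorem expect_comm (p : PMF α) (q : PMF γ) (f : α → γ → ℝ≥0∞) :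
    (expect p fun a => expect q fun c => f a c) = expect q fun c => expect p fun a => f a c := by
  simp only [expect, ← ENNReal.tsum_mul_left]
  rw [ENNReal.tsum_comm]
  simp only [mul_left_comm]

theorem expect_iidDraws_succ (g : PMF B) (N : ℕ) (f : List B → ℝ≥0∞) :
    expect (iidDraws g (N + 1)) f =
      expect g fun b => expect (iidDraws g N) fun Ys => f (b :: Ys) := by
  simp only [iidDraws, expect_bind, expect_map]

theorem mem_support_of_mem_iidDraws {g : PMF B} {N : ℕ} {Ys : List B}
    (h : Ys ∈ (iidDraws g N).support) : Ys.length = N ∧ ∀ c ∈ Ys, c ∈ g.support := by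
  induction N generalizing Ys with
  | zero =>
    simp only [iidDraws, PMF.support_pure, Set.mem_singleton_iff] at h
    simp [h]
  | succ N ih =>
    simp only [iidDraws, PMF.mem_support_bind_iff, PMF.mem_support_map_iff] at h
    obtain ⟨b, hb, Zs, hZ, rfl⟩ := h
    obtain ⟨h1, h2⟩ := ih hZ
    refine ⟨by simp [h1], fun c hc => ?_⟩
    rcases List.mem_cons.1 hc with rfl | hc
    · exact hb
    · exact h2 c hc

/-- Exchangeability: a symmetric sum over i.i.d. draws reduces to its first term. -/
theorem expect_iidDraws_sum_mul (g : PMF B) (ψ w : B → ℝ≥0∞) (f : ℝ≥0∞ → ℝ≥0∞) (N : ℕ)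
    (a : ℝ≥0∞) :
    (expect (iidDraws g (N + 1)) fun Ys => (Ys.map ψ).sum * f (a + (Ys.map w).sum)) =
      (N + 1) * expect g fun b => ψ b *
        expect (iidDraws g N) fun Ys => f (a + w b + (Ys.map w).sum) := by
  -- The offset `a` carries the weight of the draws already split off.
  induction N generalizing a with
  | zero =>
    rw [expect_iidDraws_succ]
    simp [iidDraws, expect_pure]
  | succ N ih =>
    rw [expect_iidDraws_succ]
    simp only [List.map_cons, List.sum_cons, add_mul, ← add_assoc, expect_add, expect_const_mul, ih,
      Nat.cast_add, Nat.cast_one, one_mul]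
    rw [add_comm, expect_comm]
    simp only [expect_const_mul]
    have key : (expect g fun b => ψ b * expect g fun c => expect (iidDraws g N) fun Ys =>
        f (a + w c + w b + (Ys.map w).sum)) = expect g fun b => ψ b *
          expect (iidDraws g (N + 1)) fun Ys => f (a + w b + (Ys.map w).sum) := by
      refine congrArg _ (funext fun b => ?_)
      rw [expect_iidDraws_succ]
      simp only [List.map_cons, List.sum_cons, ← add_assoc, add_right_comm a]
    rw [key]
    ring

theorem expect_iidDraws_prod (g : PMF B) (θ : B → ℝ≥0∞) (N : ℕ) :
    (expect (iidDraws g N) fun Ys => (Ys.map θ).prod) = expect g θ ^ N := by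
  induction N with
  | zero => simp [iidDraws, expect_pure]
  | succ N ih =>
    rw [expect_iidDraws_succ]
    simp only [List.map_cons, List.prod_cons, expect_const_mul, ih]
    simp only [mul_comm _ (expect g θ ^ N), expect_const_mul, pow_succ]

theorem expect_subSample {g : PMF B} {w : B → ℝ≥0∞} {Ys : List B} (h0 : (Ys.map w).sum ≠ 0)
    (h1 : (Ys.map w).sum ≠ ∞) (φ : B → ℝ≥0∞) :
    expect (subSample g w Ys) φ = (Ys.map fun b => w b * φ b).sum * ((Ys.map w).sum)⁻¹ := by
  have hsum : (∑' i : Fin Ys.length, w (Ys.get i)) = (Ys.map w).sum := by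
    rw [tsum_fintype]
    exact Fin.sum_univ_fun_getElem Ys w
  rw [subSample, dif_pos (by rw [hsum]; exact ⟨h0, h1⟩), expect_map, expect]
  simp only [PMF.normalize_apply, hsum]
  rw [tsum_fintype, ← Fin.sum_univ_fun_getElem Ys fun b => w b * φ b, Finset.sum_mul]
  refine Finset.sum_congr rfl fun i _ => ?_
  simp only [List.get_eq_getElem]
  ring

theorem list_sum_ne_top {w : B → ℝ≥0∞} {Ys : List B} (h : ∀ b ∈ Ys, w b ≠ ∞) :
    (Ys.map w).sum ≠ ∞ := by
  induction Ys with
  | nil => simp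
  | cons b Ys ih =>
    simp only [List.map_cons, List.sum_cons]
    exact ENNReal.add_ne_top.2 ⟨h b (by simp), ih fun c hc => h c (by simp [hc])⟩

end Draws

/-! ### The Poissonized beam -/

section Poisson

theorem poisson_toPMF_apply (n N : ℕ) :
    (poissonMeasure (n : ℝ≥0)).toPMF N =
      ENNReal.ofReal (Real.exp (-n) * (n : ℝ) ^ N / N.factorial) := by
  rw [Measure.toPMF_apply, poissonMeasure_singleton]
  simp

/-- The right side is the Poisson generating function at `x`. -/
theorem expect_poisson_pow_le (n : ℕ) {t : ℝ≥0∞} {x : ℝ} (hx : 0 ≤ x)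
    (ht : t ≤ ENNReal.ofReal x) :
    (expect (poissonMeasure (n : ℝ≥0)).toPMF fun N => t ^ N) ≤
      ENNReal.ofReal (Real.exp (-(n * (1 - x)))) := by
  have hs : HasSum (fun N : ℕ => Real.exp (-n) * (((n : ℝ) * x) ^ N / N.factorial))
      (Real.exp (-n) * Real.exp (n * x)) := by
    have := NormedSpace.expSeries_div_hasSum_exp ((n : ℝ) * x)
    rw [← Real.exp_eq_exp_ℝ] at this
    exact this.mul_left _
  rw [show -(n * (1 - x)) = -(n : ℝ) + n * x by ring, Real.exp_add, ← hs.tsum_eq,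
    ENNReal.ofReal_tsum_of_nonneg (fun N => by positivity) hs.summable]
  refine ENNReal.tsum_le_tsum fun N => ?_
  rw [poisson_toPMF_apply]
  refine (mul_le_mul_right (pow_le_pow_left₀ zero_le ht N) _).trans_eq ?_
  rw [← ENNReal.ofReal_pow hx, ← ENNReal.ofReal_mul (by positivity)]
  congr 1
  rw [mul_pow]
  ring

/-- The factor `n / (1 - e^{-n})` of the conditioned Poisson beam. -/
def beamFactor (n : ℕ) : ℝ≥0∞ :=
  n * (∑' N, ({N : ℕ | 0 < N}.indicator (poissonMeasure (n : ℝ≥0)).toPMF) N)⁻¹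

/-- Size-biasing: the factor `N + 1` left by exchangeability is absorbed, and the remaining `N`
draws have an unconditioned Poisson count. -/
theorem poissonBeam_succ (n : ℕ) (hn : 0 < n) (N : ℕ) :
    poissonBeam n hn (N + 1) * (N + 1) =
      beamFactor n * (poissonMeasure (n : ℝ≥0)).toPMF N := by
  rw [poissonBeam, PMF.filter_apply, beamFactor,
    Set.indicator_of_mem (show N + 1 ∈ {N : ℕ | 0 < N} from Nat.succ_pos N),
    poisson_toPMF_apply, poisson_toPMF_apply, mul_right_comm, mul_right_comm (n : ℝ≥0∞)]
  congr 1
  rw [← ENNReal.ofReal_natCast n, show ((N : ℝ≥0∞) + 1) = ENNReal.ofReal ((N : ℝ) + 1) by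
    rw [ENNReal.ofReal_add (by positivity) zero_le_one]; simp,
    ← ENNReal.ofReal_mul (by positivity), ← ENNReal.ofReal_mul (by positivity)]
  congr 1
  rw [Nat.factorial_succ]
  push_cast
  field_simp
  ring

theorem poissonBeam_zero (n : ℕ) (hn : 0 < n) : poissonBeam n hn 0 = 0 :=
  PMF.filter_apply_eq_zero_of_notMem _ (by simp)

theorem beamFactor_le (n : ℕ) (hn : 3 ≤ n) : beamFactor n ≤ ENNReal.ofReal (2 * n) := by
  set Z := ∑' N, ({N : ℕ | 0 < N}.indicator (poissonMeasure (n : ℝ≥0)).toPMF) N with hZ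
  have h1 : (1 : ℝ≥0∞) = ENNReal.ofReal (Real.exp (-n)) + Z := by
    have h := (poissonMeasure (n : ℝ≥0)).toPMF.tsum_coe
    rw [tsum_eq_zero_add' ENNReal.summable, poisson_toPMF_apply] at h
    have hZ' : Z = ∑' N, (poissonMeasure (n : ℝ≥0)).toPMF (N + 1) := by
      rw [hZ, tsum_eq_zero_add' ENNReal.summable]
      simp
    rw [← h, hZ']
    simp
  have h2 : Real.exp (-n) ≤ 1 / 2 := by
    have h3 : (3 : ℝ) ≤ n := by exact_mod_cast hn
    have h4 := Real.add_one_le_exp (n : ℝ)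
    rw [Real.exp_neg, inv_le_comm₀ (Real.exp_pos _) (by norm_num)]
    linarith
  have h5 : ENNReal.ofReal (1 / 2) ≤ Z := by
    have h6 : ENNReal.ofReal (1 / 2) + ENNReal.ofReal (1 / 2) ≤ ENNReal.ofReal (1 / 2) + Z := by
      rw [← ENNReal.ofReal_add (by norm_num) (by norm_num)]
      rw [add_halves, ENNReal.ofReal_one, h1]
      gcongr
    exact (ENNReal.add_le_add_iff_left ENNReal.ofReal_ne_top).1 h6
  have h7 : Z⁻¹ ≤ ENNReal.ofReal 2 := by
    rw [ENNReal.inv_le_iff_inv_le, ← ENNReal.ofReal_inv_of_pos (by norm_num)]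
    simpa using h5
  rw [beamFactor, ← hZ, mul_comm 2, ENNReal.ofReal_mul (by positivity), ENNReal.ofReal_natCast]
  gcongr

end Poisson

/-! ### The law of the selected block -/

section BlockLaw

variable {B : Type*}

/-- The law of the block selected in one iteration with generator `g` and weights `w`. -/
def blockLaw (g : PMF B) (w : B → ℝ≥0∞) (beam : PMF ℕ) : PMF B :=
  beam.bind fun N => (iidDraws g N).bind fun Ys => subSample g w Ys

/-- A Poisson number of i.i.d. draws. -/
def compoundPoisson (g : PMF B) (n : ℕ) : PMF (List B) :=
  (poissonMeasure (n : ℝ≥0)).toPMF.bind (iidDraws g)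

/-- The density of the selected block with respect to the tilted law. -/
def blockDensity (g : PMF B) (w : B → ℝ≥0∞) (n : ℕ) (b : B) : ℝ≥0∞ :=
  beamFactor n * expect (compoundPoisson g n) fun Ys => (w b + (Ys.map w).sum)⁻¹

/-- Mecke's formula for the Poisson sample: single out the selected draw, and the others form an
independent Poisson sample. -/
theorem expect_blockLaw {g : PMF B} {w : B → ℝ≥0∞} (h0 : ∀ b ∈ g.support, w b ≠ 0)
    (h1 : ∀ b ∈ g.support, w b ≠ ∞) (n : ℕ) (hn : 0 < n) (φ : B → ℝ≥0∞) :
    expect (blockLaw g w (poissonBeam n hn)) φ =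
      expect g fun b => w b * φ b * blockDensity g w n b := by
  have hN : ∀ N, expect (iidDraws g (N + 1)) (fun Ys => expect (subSample g w Ys) φ) =
      (N + 1) * expect g fun b => w b * φ b *
        expect (iidDraws g N) fun Ys => (w b + (Ys.map w).sum)⁻¹ := by
    intro N
    have := expect_iidDraws_sum_mul g (fun b => w b * φ b) w (fun s => s⁻¹) N 0
    simp only [zero_add] at this
    rw [← this]
    refine expect_congr_of_support fun Ys hYs => ?_
    obtain ⟨hlen, hmem⟩ := mem_support_of_mem_iidDraws hYs
    refine expect_subSample ?_ (list_sum_ne_top fun b hb => h1 b (hmem b hb)) φ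
    obtain ⟨b, Zs, rfl⟩ := List.exists_cons_of_length_eq_add_one hlen
    simp [h0 b (hmem b (by simp))]
  rw [blockLaw, expect_bind]
  simp only [expect_bind]
  -- The empty beam has mass zero, so the fallback draw of `subSample` does not contribute.
  rw [expect, tsum_eq_zero_add' ENNReal.summable, poissonBeam_zero, zero_mul, zero_add]
  simp only [hN, ← mul_assoc, poissonBeam_succ]
  simp only [mul_assoc, ENNReal.tsum_mul_left]
  simp only [blockDensity, compoundPoisson, expect_bind]
  rw [← expect, expect_comm, ← expect_const_mul]
  refine congrArg _ (funext fun b => ?_)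
  rw [← expect_const_mul, ← expect_const_mul, ← expect_const_mul, ← expect_const_mul]
  refine congrArg _ (funext fun N => ?_)
  ring

theorem blockLaw_apply {g Q : PMF B} {w : B → ℝ≥0∞} (hQ : ∀ b, Q b = g b * w b)
    (h0 : ∀ b ∈ g.support, w b ≠ 0) (h1 : ∀ b ∈ g.support, w b ≠ ∞) (n : ℕ) (hn : 0 < n) (b : B) :
    blockLaw g w (poissonBeam n hn) b = Q b * blockDensity g w n b := by
  classical
  rw [← expect_indicator (blockLaw _ _ _) b, expect_blockLaw h0 h1, expect, tsum_eq_single b]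
  · simp [hQ, mul_assoc]
  · intro c hc
    simp [hc]

end BlockLaw

/-! ### Bounds on the density of the selected block -/

/-! ### Elementary real inequalities -/

section RealBounds

theorem inv_add_le_inv_add_add {M m x y s : ℝ} (hm : 0 < m) (hx : m ≤ x) (hy : m ≤ y) (hyM : y ≤ M)
    (hs : 0 ≤ s) : (x + s)⁻¹ ≤ (y + s)⁻¹ + M * ((m + s) ^ 2)⁻¹ := by
  have hxs : 0 < x + s := by linarith
  have hys : 0 < y + s := by linarith
  have hms : 0 < m + s := by linarith
  have h1 : (x + s)⁻¹ - (y + s)⁻¹ = (y - x) * ((x + s) * (y + s))⁻¹ := by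
    field_simp
    ring
  have h2 : (y - x) * ((x + s) * (y + s))⁻¹ ≤ M * ((m + s) ^ 2)⁻¹ := by
    have h3 : (m + s) ^ 2 ≤ (x + s) * (y + s) := by nlinarith
    have h4 : ((x + s) * (y + s))⁻¹ ≤ ((m + s) ^ 2)⁻¹ := inv_anti₀ (by positivity) h3
    exact mul_le_mul (by linarith) h4 (by positivity) (by linarith)
  linarith

/-- A pointwise Chernoff bound split at `s = N / 4`: above it the first term suffices, below it the
product of exponentials is at least one. -/
theorem inv_sq_le_add_exp {M m s N : ℝ} (hm : 0 < m) (hM : 0 < M) (hN : 0 < N) (hs : 0 ≤ s) :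
    ((m + s) ^ 2)⁻¹ ≤ 16 / N ^ 2 + (m ^ 2)⁻¹ * (Real.exp (N / (4 * M)) * Real.exp (-(s / M))) := by
  rcases le_total (N / 4) s with h | h
  · have h1 : (N / 4) ^ 2 ≤ (m + s) ^ 2 := by gcongr; linarith
    have h2 := inv_anti₀ (by positivity) h1
    have h3 : ((N / 4) ^ 2)⁻¹ = 16 / N ^ 2 := by field_simp; norm_num
    rw [h3] at h2
    have : 0 ≤ (m ^ 2)⁻¹ * (Real.exp (N / (4 * M)) * Real.exp (-(s / M))) := by positivity
    linarith
  · have h1 : m ^ 2 ≤ (m + s) ^ 2 := by gcongr; linarith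
    have h2 := inv_anti₀ (by positivity) h1
    have h3 : 1 ≤ Real.exp (N / (4 * M)) * Real.exp (-(s / M)) := by
      rw [← Real.exp_add, Real.one_le_exp_iff]
      have : N / (4 * M) + -(s / M) = (N / 4 - s) / M := by
        field_simp
        ring
      rw [this]
      exact div_nonneg (by linarith) hM.le
    have h4 := le_mul_of_one_le_right (inv_nonneg.2 (sq_nonneg m)) h3
    have : 0 ≤ 16 / N ^ 2 := by positivity
    linarith

theorem exp_neg_le_one_sub_half {x : ℝ} (h0 : 0 ≤ x) (h1 : x ≤ 1) :
    Real.exp (-x) ≤ 1 - x / 2 := by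
  have h := Real.quadratic_le_exp_of_nonneg h0
  rw [Real.exp_neg, inv_le_comm₀ (Real.exp_pos _) (by linarith)]
  refine le_trans ?_ h
  rw [inv_le_iff_one_le_mul₀ (by linarith)]
  nlinarith [mul_nonneg h0 (sub_nonneg.2 h1), mul_nonneg (mul_nonneg h0 h0) (sub_nonneg.2 h1)]

end RealBounds

/-! ### Ratio and oscillation of the density -/

section DensityBounds

variable {B : Type*} {g Q : PMF B} {w : B → ℝ≥0∞} {M : ℝ}

theorem mem_support_of_mem_compoundPoisson {n : ℕ} {Ys : List B}
    (h : Ys ∈ (compoundPoisson g n).support) : ∀ c ∈ Ys, c ∈ g.support := by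
  rw [compoundPoisson, PMF.mem_support_bind_iff] at h
  obtain ⟨N, _, hN⟩ := h
  exact (mem_support_of_mem_iidDraws hN).2

theorem list_prod_ofReal_exp {Ys : List B} (h : ∀ b ∈ Ys, w b ≠ ∞) :
    (Ys.map fun b => ENNReal.ofReal (Real.exp (-((w b).toReal / M)))).prod =
      ENNReal.ofReal (Real.exp (-(((Ys.map w).sum).toReal / M))) := by
  induction Ys with
  | nil => simp
  | cons b Ys ih =>
    have hY : ∀ c ∈ Ys, w c ≠ ∞ := fun c hc => h c (by simp [hc])
    rw [List.map_cons, List.prod_cons, ih hY, List.map_cons, List.sum_cons,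
      ENNReal.toReal_add (h b (by simp)) (list_sum_ne_top hY), ← ENNReal.ofReal_mul (by positivity),
      ← Real.exp_add]
    congr 2
    ring

/-- The weights have `g`-mean one, being the density of `Q`; integrate `exp (-z) ≤ 1 - z / 2` at `z
= w / M`, which is at most one. -/
theorem expect_exp_le (hM : 1 ≤ M) (hQ : ∀ b, Q b = g b * w b)
    (hw : ∀ b ∈ g.support, w b ≤ ENNReal.ofReal M) :
    (expect g fun b => ENNReal.ofReal (Real.exp (-((w b).toReal / M)))) ≤
      ENNReal.ofReal (1 - 1 / (2 * M)) := by
  have hM0 : 0 < M := by linarith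
  have h1 : (expect g fun b => ENNReal.ofReal (Real.exp (-((w b).toReal / M))) +
      ENNReal.ofReal (1 / (2 * M)) * w b) ≤ expect g fun _ => 1 := by
    refine expect_mono_of_support fun b hb => ?_
    have hf : w b ≠ ∞ := ne_top_of_le_ne_top ENNReal.ofReal_ne_top (hw b hb)
    have hle : (w b).toReal ≤ M := ENNReal.toReal_le_of_le_ofReal hM0.le (hw b hb)
    conv_lhs => rw [← ENNReal.ofReal_toReal hf]
    rw [ENNReal.toReal_ofReal ENNReal.toReal_nonneg,
      ← ENNReal.ofReal_mul (by positivity), ← ENNReal.ofReal_add (by positivity) (by positivity),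
      ← ENNReal.ofReal_one]
    refine ENNReal.ofReal_le_ofReal ?_
    have := exp_neg_le_one_sub_half (x := (w b).toReal / M) (by positivity)
      ((div_le_one hM0).2 hle)
    have e : 1 / (2 * M) * (w b).toReal = (w b).toReal / M / 2 := by field_simp
    rw [e]
    linarith
  have hmean : expect g w = 1 := by
    rw [← Q.tsum_coe, expect]
    simp only [hQ]
  rw [expect_add, expect_const_mul, expect_const, hmean, mul_one] at h1
  rw [ENNReal.ofReal_sub _ (by positivity), ENNReal.ofReal_one]
  exact ENNReal.le_sub_of_add_le_right ENNReal.ofReal_ne_top h1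

theorem expect_compoundPoisson_exp_le (hM : 1 ≤ M) (hQ : ∀ b, Q b = g b * w b)
    (hw : ∀ b ∈ g.support, w b ≤ ENNReal.ofReal M) (n : ℕ) :
    (expect (compoundPoisson g n) fun Ys =>
        ENNReal.ofReal (Real.exp (-(((Ys.map w).sum).toReal / M)))) ≤
      ENNReal.ofReal (Real.exp (-(n / (2 * M)))) := by
  have h1 : (expect (compoundPoisson g n) fun Ys =>
      ENNReal.ofReal (Real.exp (-(((Ys.map w).sum).toReal / M)))) =
      expect (compoundPoisson g n) fun Ys =>
        (Ys.map fun b => ENNReal.ofReal (Real.exp (-((w b).toReal / M)))).prod :=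
    expect_congr_of_support fun Ys hYs => (list_prod_ofReal_exp fun b hb =>
      ne_top_of_le_ne_top ENNReal.ofReal_ne_top
        (hw b (mem_support_of_mem_compoundPoisson hYs b hb))).symm
  rw [h1, compoundPoisson, expect_bind]
  simp only [expect_iidDraws_prod]
  have h2 : 0 ≤ 1 - 1 / (2 * M) := by
    rw [sub_nonneg, div_le_one (by linarith)]
    linarith
  refine (expect_poisson_pow_le n h2 (expect_exp_le hM hQ hw)).trans_eq ?_
  congr 3
  ring

/-- Since `w c ≤ M ^ 2 * w b`, the two denominators `w · + S` differ by a factor of at most `M ^ 2`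
for every sample. -/
theorem blockDensity_le_mul (hM : 1 ≤ M)
    (hw : ∀ b ∈ g.support, ENNReal.ofReal M⁻¹ ≤ w b ∧ w b ≤ ENNReal.ofReal M) (n : ℕ) {b c : B}
    (hb : b ∈ g.support) (hc : c ∈ g.support) :
    blockDensity g w n b ≤ ENNReal.ofReal (M ^ 2) * blockDensity g w n c := by
  have hM0 : 0 < M := by linarith
  rw [blockDensity, blockDensity, mul_left_comm, ← expect_const_mul _ (ENNReal.ofReal (M ^ 2))]
  refine mul_le_mul_right (expect_mono_of_support fun Ys _ => ?_) _
  have h1 : w c + (Ys.map w).sum ≤ ENNReal.ofReal (M ^ 2) * (w b + (Ys.map w).sum) := by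
    rw [mul_add]
    refine add_le_add ?_ (le_mul_of_one_le_left zero_le ?_)
    · calc w c ≤ ENNReal.ofReal M := (hw c hc).2
        _ = ENNReal.ofReal (M ^ 2) * ENNReal.ofReal M⁻¹ := by
          rw [← ENNReal.ofReal_mul (by positivity)]
          congr 1
          field_simp
        _ ≤ _ := mul_le_mul_right (hw b hb).1 _
    · rw [ENNReal.one_le_ofReal]
      exact one_le_pow₀ hM
  have hne : ENNReal.ofReal (M ^ 2) ≠ 0 := by
    rw [Ne, ENNReal.ofReal_eq_zero, not_le]
    positivity
  calc (w b + (Ys.map w).sum)⁻¹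
      = ENNReal.ofReal (M ^ 2) * (ENNReal.ofReal (M ^ 2) * (w b + (Ys.map w).sum))⁻¹ := by
        rw [ENNReal.mul_inv (Or.inl hne) (Or.inl ENNReal.ofReal_ne_top), ← mul_assoc,
          ENNReal.mul_inv_cancel hne ENNReal.ofReal_ne_top, one_mul]
    _ ≤ _ := mul_le_mul_right (ENNReal.inv_le_inv.2 h1) _

/-- The oscillation of the density of the selected block. -/
def densityGap (M : ℝ) (n : ℕ) : ℝ :=
  2 * n * (16 * M / (n : ℝ) ^ 2 + M ^ 3 * Real.exp (-(n / (4 * M))))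

theorem densityGap_nonneg (hM : 0 ≤ M) (n : ℕ) : 0 ≤ densityGap M n := by
  unfold densityGap
  positivity

theorem blockDensity_le_add (hM : 1 ≤ M) (hQ : ∀ b, Q b = g b * w b)
    (hw : ∀ b ∈ g.support, ENNReal.ofReal M⁻¹ ≤ w b ∧ w b ≤ ENNReal.ofReal M) {n : ℕ} (hn : 3 ≤ n)
    {b c : B} (hb : b ∈ g.support) (hc : c ∈ g.support) :
    blockDensity g w n b ≤ blockDensity g w n c + ENNReal.ofReal (densityGap M n) := by
  have hM0 : 0 < M := by linarith
  have hn0 : (0 : ℝ) < n := by exact_mod_cast (by omega : 0 < n)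
  have hfin : ∀ b ∈ g.support, w b ≠ ∞ := fun b hb =>
    ne_top_of_le_ne_top ENNReal.ofReal_ne_top (hw b hb).2
  have hlow : ∀ b ∈ g.support, M⁻¹ ≤ (w b).toReal := fun b hb =>
    (ENNReal.ofReal_le_iff_le_toReal (hfin b hb)).1 (hw b hb).1
  have hpt : ∀ Ys ∈ (compoundPoisson g n).support, (w b + (Ys.map w).sum)⁻¹ ≤
      (w c + (Ys.map w).sum)⁻¹ + (ENNReal.ofReal (16 * M / (n : ℝ) ^ 2) +
        ENNReal.ofReal (M ^ 3 * Real.exp (n / (4 * M))) *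
          ENNReal.ofReal (Real.exp (-(((Ys.map w).sum).toReal / M)))) := by
    intro Ys hYs
    have hS : (Ys.map w).sum ≠ ∞ := list_sum_ne_top fun a ha =>
      hfin a (mem_support_of_mem_compoundPoisson hYs a ha)
    have hinv : ∀ a ∈ g.support, (w a + (Ys.map w).sum)⁻¹ =
        ENNReal.ofReal (((w a).toReal + ((Ys.map w).sum).toReal)⁻¹) := fun a ha => by
      have h0 : 0 < (w a).toReal := (inv_pos.2 hM0).trans_le (hlow a ha)
      rw [ENNReal.ofReal_inv_of_pos (by positivity),
        ENNReal.ofReal_add ENNReal.toReal_nonneg ENNReal.toReal_nonneg,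
        ENNReal.ofReal_toReal (hfin a ha), ENNReal.ofReal_toReal hS]
    rw [hinv b hb, hinv c hc, ← ENNReal.ofReal_mul (by positivity),
      ← ENNReal.ofReal_add (by positivity) (by positivity),
      ← ENNReal.ofReal_add (by positivity) (by positivity)]
    refine ENNReal.ofReal_le_ofReal ?_
    have hs0 : 0 ≤ ((Ys.map w).sum).toReal := ENNReal.toReal_nonneg
    refine (inv_add_le_inv_add_add (inv_pos.2 hM0) (hlow b hb) (hlow c hc)
      (ENNReal.toReal_le_of_le_ofReal hM0.le (hw c hc).2) hs0).trans ?_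
    have h := mul_le_mul_of_nonneg_left
      (inv_sq_le_add_exp (inv_pos.2 hM0) hM0 hn0 hs0) hM0.le
    have e : (M⁻¹ ^ 2)⁻¹ = M ^ 2 := by field_simp
    rw [e] at h
    have e2 : M * (16 / (n : ℝ) ^ 2 + M ^ 2 * (Real.exp (n / (4 * M)) *
        Real.exp (-(((Ys.map w).sum).toReal / M)))) = 16 * M / (n : ℝ) ^ 2 +
        M ^ 3 * Real.exp (n / (4 * M)) * Real.exp (-(((Ys.map w).sum).toReal / M)) := by ring
    rw [e2] at h
    linarith
  have hmain := expect_mono_of_support hpt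
  rw [expect_add, expect_add, expect_const, expect_const_mul] at hmain
  have hexp := expect_compoundPoisson_exp_le hM hQ (fun b hb => (hw b hb).2) n
  -- The Laplace exponent `n / (2M)` exceeds the cost `n / (4M)` of the threshold `n / 4`, leaving
  -- `-n / (4M)`.
  have hgap : ENNReal.ofReal (16 * M / (n : ℝ) ^ 2) +
      ENNReal.ofReal (M ^ 3 * Real.exp (n / (4 * M))) *
        ENNReal.ofReal (Real.exp (-(n / (2 * M)))) =
      ENNReal.ofReal (16 * M / (n : ℝ) ^ 2 + M ^ 3 * Real.exp (-(n / (4 * M)))) := by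
    rw [← ENNReal.ofReal_mul (by positivity), ← ENNReal.ofReal_add (by positivity) (by positivity),
      mul_assoc, ← Real.exp_add]
    congr 4
    field_simp
    ring
  rw [blockDensity, blockDensity, densityGap, ENNReal.ofReal_mul (by positivity), ← hgap]
  calc _ ≤ beamFactor n * _ := mul_le_mul_right hmain _
    _ ≤ _ := by
      rw [mul_add]
      gcongr
      exact beamFactor_le n hn

end DensityBounds

/-! ### The entropy of one iteration -/

section StepEntropy

variable {B : Type*} {g Q : PMF B} {w : B → ℝ≥0∞} {M : ℝ}

theorem mem_support_iff_of_weight (hM : 0 < M) (hQ : ∀ b, Q b = g b * w b)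
    (hw : ∀ b ∈ g.support, ENNReal.ofReal M⁻¹ ≤ w b ∧ w b ≤ ENNReal.ofReal M) (b : B) :
    b ∈ Q.support ↔ b ∈ g.support := by
  rw [PMF.mem_support_iff, hQ, mul_ne_zero_iff, PMF.mem_support_iff]
  refine ⟨fun h => h.1, fun h => ⟨h, fun h0 => ?_⟩⟩
  have := (hw b ((PMF.mem_support_iff _ _).2 h)).1
  rw [h0, nonpos_iff_eq_zero, ENNReal.ofReal_eq_zero] at this
  exact absurd (inv_pos.2 hM) (not_lt.2 this)

theorem expect_blockDensity (hM : 1 ≤ M) (hQ : ∀ b, Q b = g b * w b)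
    (hw : ∀ b ∈ g.support, ENNReal.ofReal M⁻¹ ≤ w b ∧ w b ≤ ENNReal.ofReal M) {n : ℕ}
    (hn : 0 < n) : expect Q (blockDensity g w n) = 1 := by
  have hM0 : 0 < M := by linarith
  rw [expect, ← (blockLaw g w (poissonBeam n hn)).tsum_coe]
  refine tsum_congr fun b => (blockLaw_apply hQ (fun a ha h0 => ?_) (fun a ha => ?_) n hn b).symm
  · exact ((PMF.mem_support_iff _ _).1
      ((mem_support_iff_of_weight hM0 hQ hw a).2 ha)) (by rw [hQ, h0, mul_zero])
  · exact ne_top_of_le_ne_top ENNReal.ofReal_ne_top (hw a ha).2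

/-- Having mean one, the density is within its oscillation of one and is at most its largest ratio
`M ^ 2`. Each fact gives one of the bounds. -/
theorem entropyLe_blockLaw (hM : 1 ≤ M) (hQ : ∀ b, Q b = g b * w b)
    (hw : ∀ b ∈ g.support, ENNReal.ofReal M⁻¹ ≤ w b ∧ w b ≤ ENNReal.ofReal M) {n : ℕ}
    (hn : 3 ≤ n) (hn0 : 0 < n) :
    EntropyLe (blockLaw g w (poissonBeam n hn0)) Q
        (ENNReal.ofReal (densityGap M n ^ 2)) ∧
      EntropyLe (blockLaw g w (poissonBeam n hn0)) Q
        (ENNReal.ofReal (Real.log (M ^ 2))) := by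
  have hM0 : 0 < M := by linarith
  have hsupp := mem_support_iff_of_weight hM0 hQ hw
  have hmean := expect_blockDensity hM hQ hw hn0
  have hgap := densityGap_nonneg hM0.le n
  have hM2 : 0 ≤ M ^ 2 := sq_nonneg M
  have b1 : ∀ b ∈ Q.support, blockDensity g w n b ≤ ENNReal.ofReal (M ^ 2) := fun b hb => by
    rw [← expect_const Q (blockDensity g w n b), ← mul_one (ENNReal.ofReal (M ^ 2)), ← hmean,
      ← expect_const_mul]
    exact expect_mono_of_support fun c hc =>
      blockDensity_le_mul hM hw n ((hsupp b).1 hb) ((hsupp c).1 hc)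
  have b2 : ∀ b ∈ Q.support, blockDensity g w n b ≤ 1 + ENNReal.ofReal (densityGap M n) :=
    fun b hb => by
      rw [← expect_const Q (blockDensity g w n b), ← hmean,
        ← expect_const Q (ENNReal.ofReal (densityGap M n)), ← expect_add]
      exact expect_mono_of_support fun c hc =>
        blockDensity_le_add hM hQ hw hn ((hsupp b).1 hb) ((hsupp c).1 hc)
  have b3 : ∀ b ∈ Q.support, 1 ≤ blockDensity g w n b + ENNReal.ofReal (densityGap M n) :=
    fun b hb => by
      rw [← hmean, ← expect_const Q (blockDensity g w n b + ENNReal.ofReal (densityGap M n))]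
      exact expect_mono_of_support fun c hc =>
        blockDensity_le_add hM hQ hw hn ((hsupp c).1 hc) ((hsupp b).1 hb)
  have hfin : ∀ b ∈ Q.support, blockDensity g w n b ≠ ∞ := fun b hb =>
    ne_top_of_le_ne_top ENNReal.ofReal_ne_top (b1 b hb)
  have hPQ : ∀ b, blockLaw g w (poissonBeam n hn0) b =
      Q b * ENNReal.ofReal (blockDensity g w n b).toReal := fun b => by
    rw [blockLaw_apply hQ (fun a ha h0 => ?_) (fun a ha => ?_) n hn0 b]
    · by_cases hb : Q b = 0
      · simp [hb]
      · rw [ENNReal.ofReal_toReal (hfin b ((PMF.mem_support_iff _ _).2 hb))]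
    · exact ((PMF.mem_support_iff _ _).1 ((hsupp a).2 ha)) (by rw [hQ, h0, mul_zero])
    · exact ne_top_of_le_ne_top ENNReal.ofReal_ne_top (hw a ha).2
  constructor
  -- The chi-square bound `x log x ≤ x (x - 1) = (x - 1) ^ 2 + (x - 1)`.
  · refine entropyLe_of_density (c := 1) (fun b => ENNReal.toReal_nonneg) hPQ fun b hb => ?_
    set x := (blockDensity g w n b).toReal with hx
    have hx0 : 0 ≤ x := ENNReal.toReal_nonneg
    have h2 : x ≤ 1 + densityGap M n := by
      have := ENNReal.toReal_mono (by finiteness) (b2 b hb)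
      rwa [ENNReal.toReal_add (by finiteness) (by finiteness), ENNReal.toReal_one,
        ENNReal.toReal_ofReal hgap] at this
    have h3 : 1 ≤ x + densityGap M n := by
      have := ENNReal.toReal_mono (ENNReal.add_ne_top.2 ⟨hfin b hb, by finiteness⟩) (b3 b hb)
      rwa [ENNReal.toReal_add (hfin b hb) (by finiteness), ENNReal.toReal_one,
        ENNReal.toReal_ofReal hgap] at this
    have h4 : (x - 1) ^ 2 ≤ densityGap M n ^ 2 := sq_le_sq' (by linarith) (by linarith)
    rcases hx0.eq_or_lt with h0 | h0
    · rw [← h0] at h4 ⊢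
      simp at h4 ⊢
      linarith
    · have h5 := mul_le_mul_of_nonneg_left (Real.log_le_sub_one_of_pos h0) hx0
      nlinarith
  -- Here `x log x ≤ x log (M ^ 2)`, which is already of the required affine form.
  · refine entropyLe_of_density (c := Real.log (M ^ 2)) (fun b => ENNReal.toReal_nonneg) hPQ
      fun b hb => ?_
    set x := (blockDensity g w n b).toReal with hx
    have hx0 : 0 ≤ x := ENNReal.toReal_nonneg
    have h1 : x ≤ M ^ 2 := ENNReal.toReal_le_of_le_ofReal hM2 (b1 b hb)
    rcases hx0.eq_or_lt with h0 | h0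
    · rw [← h0]
      simp
    · have := mul_le_mul_of_nonneg_left (Real.log_le_log h0 h1) hx0
      linarith

/-- A universal constant in the entropy bound of one iteration. -/
def entropyConst : ℝ := (32 + 2 * (Nat.factorial 14 * 4 ^ 14)) ^ 2

theorem densityGap_le {n : ℕ} (hn : 0 < n) (hM : 0 < M) (hMn : M ^ 4 ≤ (n : ℝ) ^ 3) :
    densityGap M n ≤ (32 + 2 * (Nat.factorial 14 * 4 ^ 14)) * (M / n) := by
  have hn0 : (0 : ℝ) < n := by exact_mod_cast hn
  -- Order 14 makes `M ^ 3 * M ^ 14 = M * M ^ 16`, and `M ^ 16 ≤ n ^ 12` is the fourth power of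
  -- `hMn`.
  have hexp : Real.exp (-(n / (4 * M))) ≤ Nat.factorial 14 * (4 ^ 14 * M ^ 14 / (n : ℝ) ^ 14) := by
    have h := Real.pow_div_factorial_le_exp (n / (4 * M)) (by positivity) 14
    rw [Real.exp_neg]
    refine (inv_anti₀ (by positivity) h).trans_eq ?_
    rw [div_pow, mul_pow, inv_div, div_div_eq_mul_div, mul_div_assoc]
  have h16 : M ^ 16 ≤ (n : ℝ) ^ 12 := by
    have := pow_le_pow_left₀ (by positivity) hMn 4
    rwa [← pow_mul, ← pow_mul] at this
  have h1 : M ^ 3 * Real.exp (-(n / (4 * M))) ≤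
      Nat.factorial 14 * 4 ^ 14 * (M / (n : ℝ) ^ 2) := by
    calc M ^ 3 * Real.exp (-(n / (4 * M)))
        ≤ M ^ 3 * (Nat.factorial 14 * (4 ^ 14 * M ^ 14 / (n : ℝ) ^ 14)) := by gcongr
      _ = Nat.factorial 14 * 4 ^ 14 * (M * M ^ 16 / (n : ℝ) ^ 14) := by ring
      _ ≤ Nat.factorial 14 * 4 ^ 14 * (M * (n : ℝ) ^ 12 / (n : ℝ) ^ 14) := by gcongr
      _ = _ := by
        congr 1
        field_simp
  calc densityGap M n
      ≤ 2 * n * (16 * M / (n : ℝ) ^ 2 + Nat.factorial 14 * 4 ^ 14 * (M / (n : ℝ) ^ 2)) := by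
        unfold densityGap; gcongr
    _ = _ := by
      field_simp
      ring

theorem min_entropy_le {n : ℕ} (hn : 3 ≤ n) (hM : 1 ≤ M) :
    densityGap M n ^ 2 ≤ entropyConst * Real.log n * (M ^ 2 / (n : ℝ) ^ (3 / 2 : ℝ)) ∨
      Real.log (M ^ 2) ≤ entropyConst * Real.log n * (M ^ 2 / (n : ℝ) ^ (3 / 2 : ℝ)) := by
  have hM0 : 0 < M := by linarith
  have hn3 : (3 : ℝ) ≤ n := by exact_mod_cast hn
  have hn0 : (0 : ℝ) < n := by linarith
  have hlog : 1 ≤ Real.log n := by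
    rw [Real.le_log_iff_exp_le hn0]
    linarith [Real.exp_one_lt_d9]
  have hroot : 0 < (n : ℝ) ^ (3 / 2 : ℝ) := by positivity
  have hc : 0 ≤ entropyConst := sq_nonneg _
  rcases le_total (M ^ 4) ((n : ℝ) ^ 3) with h | h
  · left
    have h1 := pow_le_pow_left₀ (densityGap_nonneg hM0.le n)
      (densityGap_le (by omega) hM0 h) 2
    have h2 : (n : ℝ) ^ (3 / 2 : ℝ) ≤ (n : ℝ) ^ 2 := by
      rw [← Real.rpow_natCast]
      exact Real.rpow_le_rpow_of_exponent_le (by linarith) (by norm_num)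
    calc densityGap M n ^ 2 ≤ entropyConst * 1 * (M ^ 2 / (n : ℝ) ^ 2) := by
          refine h1.trans_eq ?_
          rw [mul_pow, div_pow, entropyConst, mul_one]
      _ ≤ _ := by gcongr
  · right
    set u := M ^ 2 / (n : ℝ) ^ (3 / 2 : ℝ) with hu
    have hMu : M ^ 2 = u * (n : ℝ) ^ (3 / 2 : ℝ) := by rw [hu]; field_simp
    have hu1 : 1 ≤ u := by
      rw [hu, one_le_div hroot]
      refine le_of_sq_le_sq ?_ (by positivity)
      rw [← Real.rpow_natCast, ← Real.rpow_mul hn0.le, ← pow_mul]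
      norm_num
      exact_mod_cast h
    -- The constant `5/2` is `1 + 3/2`, from `log (M ^ 2) = log u + (3/2) log n`, where `u ≥ 1` and
    -- `log n ≥ 1`.
    have hbig : (5 / 2 : ℝ) ≤ entropyConst := by
      unfold entropyConst
      norm_num [Nat.factorial]
    rw [hMu, Real.log_mul (by positivity) (by positivity), Real.log_rpow hn0]
    have h1 := Real.log_le_sub_one_of_pos (show 0 < u by linarith)
    have h2 : u ≤ u * Real.log n := le_mul_of_one_le_right (by linarith) hlog
    have h3 : Real.log n ≤ u * Real.log n := le_mul_of_one_le_left (by linarith) hu1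
    have h4 : 5 / 2 * (u * Real.log n) ≤ entropyConst * (u * Real.log n) := by gcongr
    linarith

/-- The relative entropy of the selected block to the tilted law. -/
theorem entropyLe_blockLaw_of_weight (hM : 1 ≤ M) (hQ : ∀ b, Q b = g b * w b)
    (hw : ∀ b ∈ g.support, ENNReal.ofReal M⁻¹ ≤ w b ∧ w b ≤ ENNReal.ofReal M) {n : ℕ}
    (hn : 3 ≤ n) (hn0 : 0 < n) :
    EntropyLe (blockLaw g w (poissonBeam n hn0)) Q
      (ENNReal.ofReal (entropyConst * Real.log n * (M ^ 2 / (n : ℝ) ^ (3 / 2 : ℝ)))) := by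
  obtain ⟨h1, h2⟩ := entropyLe_blockLaw hM hQ hw hn hn0
  intro u L hL hu1 hu2
  rcases min_entropy_le hn hM with h | h
  · exact (h1 u L hL hu1 hu2).trans (add_le_add_left (ENNReal.ofReal_le_ofReal h) _)
  · exact (h2 u L hL hu1 hu2).trans (add_le_add_left (ENNReal.ofReal_le_ofReal h) _)

end StepEntropy

/-! ### Entropy of the generated trace -/

section Chain

variable {X B : Type*}

theorem expect_step (target draft : Policy X B) (β : ℝ) (s : X → List B → B → ℝ) (τ : ℝ)
    (beam : PMF ℕ) (x : X) (tr : List B) (gen : Generator) (F : List B → ℝ≥0∞) :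
    (expect (step target draft β s τ beam x (tr, gen)) fun st => F st.1) =
      expect (blockLaw (gen.policy target draft x tr)
        (expScore (target x tr) (gen.policy target draft x tr) β (s x tr)) beam)
          fun b => F (tr ++ [b]) := by
  simp only [step, blockLaw, expect_bind, expect_map]

/-- The chain rule. The next generator depends on all candidates, hence is correlated with the
selected block, but the inductive bound holds for every generator and so can be averaged. -/
theorem entropyLe_run {target draft q : Policy X B} {H : ℕ} {β : ℝ} {s : X → List B → B → ℝ}
    {τ : ℝ} {beam : PMF ℕ} {x : X} {K : ℝ≥0∞}
    (h : ∀ (tr : List B) (gen : Generator), tr.length < H →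
      EntropyLe (blockLaw (gen.policy target draft x tr)
        (expScore (target x tr) (gen.policy target draft x tr) β (s x tr)) beam) (q x tr) K)
    (k : ℕ) (tr : List B) (gen : Generator) (hk : tr.length + k ≤ H) :
    EntropyLe ((run target draft β s τ beam x k (tr, gen)).map Prod.fst) (complete q x k tr)
      (k * K) := by
  induction k generalizing tr gen with
  | zero =>
    simpa [run, complete, PMF.pure_map] using entropyLe_self_pure tr
  | succ k ih =>
    intro u L hL h1 h2
    have hstep : ∀ F : List B × Generator → ℝ≥0∞, ∀ G : List B → ℝ≥0∞,
        (∀ b gen', F (tr ++ [b], gen') ≤ G (tr ++ [b])) →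
        expect (step target draft β s τ beam x (tr, gen)) F ≤
          expect (step target draft β s τ beam x (tr, gen)) fun st => G st.1 := by
      intro F G hFG
      refine expect_mono_of_support fun st hst => ?_
      simp only [step, PMF.mem_support_bind_iff, PMF.mem_support_map_iff] at hst
      obtain ⟨_, _, _, _, b, _, rfl⟩ := hst
      exact hFG b _
    rw [expect_map, run, expect_bind, complete, expect_bind]
    refine (hstep _ (fun tr' => k * K + posLog (expect (complete q x k tr') u))
      fun b gen' => ?_).trans ?_
    · have := ih (tr ++ [b]) gen' (by simp; omega) u L hL h1 h2
      rwa [expect_map] at this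
    · refine (expect_step target draft β s τ beam x tr gen
        fun tr' => k * K + posLog (expect (complete q x k tr') u)).trans_le ?_
      rw [expect_add, expect_const]
      -- The mean of `u` over completions under `q` is again an admissible test function, with the
      -- same bounds.
      have := h tr gen (by omega) (fun b => expect (complete q x k (tr ++ [b])) u) L hL
        (fun b => by
          rw [← expect_const (complete q x k (tr ++ [b])) 1]
          exact expect_mono_of_support fun y _ => h1 y)
        (fun b => by
          rw [← expect_const (complete q x k (tr ++ [b])) L]
          exact expect_mono_of_support fun y _ => h2 y)
      refine (add_le_add_right this _).trans_eq ?_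
      push_cast
      ring

end Chain

/-! ### The optimal law as an autoregressive policy -/

section Optimal

variable {X B : Type*}

/-- The partition function `E[exp (β r(x, Y))]` of the completions `Y` of a partial trace. -/
def partition (π : Policy X B) (H : ℕ) (β : ℝ) (r : X → List B → ℝ) (x : X) (tr : List B) : ℝ≥0∞ :=
  expect (complete π x (H - tr.length) tr) fun y => ENNReal.ofReal (Real.exp (β * r x y))

variable {π : Policy X B} {H : ℕ} {β : ℝ} {r : X → List B → ℝ} {x : X}

theorem partition_of_length_eq {tr : List B} (h : tr.length = H) :
    partition π H β r x tr = ENNReal.ofReal (Real.exp (β * r x tr)) := by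
  rw [partition, h, Nat.sub_self, complete, expect_pure]

theorem partition_of_length_lt {tr : List B} (h : tr.length < H) :
    partition π H β r x tr = expect (π x tr) fun b => partition π H β r x (tr ++ [b]) := by
  obtain ⟨k, hk⟩ : ∃ k, H - tr.length = k + 1 := ⟨H - tr.length - 1, by omega⟩
  have hk' : ∀ b, H - (tr ++ [b]).length = k := fun b => by simp; omega
  simp only [partition, hk, hk', complete, expect_bind]

theorem partition_ne_zero (tr : List B) : partition π H β r x tr ≠ 0 := by
  obtain ⟨y, hy⟩ := (complete π x (H - tr.length) tr).support_nonempty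
  intro h
  rw [partition, expect, ENNReal.tsum_eq_zero] at h
  have := h y
  rw [mul_eq_zero, ENNReal.ofReal_eq_zero] at this
  rcases this with h0 | h0
  · exact (PMF.mem_support_iff _ _).1 hy h0
  · exact absurd (Real.exp_pos _) (not_lt.2 h0)

theorem value_eq_log_partition (tr : List B) :
    value π H β r x tr = 1 / β * Real.log (partition π H β r x tr).toReal := by
  rw [value, partition, expect, ENNReal.tsum_toReal_eq]
  · simp only [ENNReal.toReal_mul, ENNReal.toReal_ofReal (Real.exp_pos _).le]
  · intro y
    exact ENNReal.mul_ne_top (PMF.apply_ne_top _ _) ENNReal.ofReal_ne_top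

theorem ofReal_exp_value (hβ : 0 < β) {tr : List B} (h : partition π H β r x tr ≠ ∞) :
    ENNReal.ofReal (Real.exp (β * value π H β r x tr)) = partition π H β r x tr := by
  rw [value_eq_log_partition, ← mul_assoc, mul_one_div_cancel hβ.ne', one_mul,
    Real.exp_log (ENNReal.toReal_pos (partition_ne_zero tr) h), ENNReal.ofReal_toReal h]

/-- Rewards need not be bounded: finiteness propagates backwards from full responses, by induction
on the number `k` of missing blocks. -/
theorem partition_ne_top (hβ : 0 < β) {R : ℝ} (hR : HasRange (prm π H β r) H R) (k : ℕ)
    (tr : List B) (hk : tr.length + k = H) : partition π H β r x tr ≠ ∞ := by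
  obtain ⟨base, hbase⟩ := hR
  induction k generalizing tr with
  | zero =>
    rw [partition_of_length_eq (by simpa using hk)]
    exact ENNReal.ofReal_ne_top
  | succ k ih =>
    have hlt : tr.length < H := by omega
    rw [partition_of_length_lt hlt]
    -- Whether or not `value` at `tr` is meaningful yet, it is a real number independent of `b`, so
    -- this bounds all one-block extensions uniformly.
    refine ne_top_of_le_ne_top (b := ENNReal.ofReal
      (Real.exp (β * (base x tr + R + value π H β r x tr)))) ENNReal.ofReal_ne_top ?_
    rw [← expect_const (π x tr) (ENNReal.ofReal _)]
    refine expect_mono_of_support fun b _ => ?_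
    rw [← ofReal_exp_value hβ (ih (tr ++ [b]) (by simp; omega))]
    refine ENNReal.ofReal_le_ofReal (Real.exp_le_exp.2 ?_)
    have := (hbase x tr hlt b).2
    rw [prm] at this
    gcongr
    linarith

theorem ofReal_exp_prm_mul (hβ : 0 < β) {R : ℝ} (hR : HasRange (prm π H β r) H R) {tr : List B}
    (h : tr.length < H) (b : B) :
    ENNReal.ofReal (Real.exp (β * prm π H β r x tr b)) * partition π H β r x tr =
      partition π H β r x (tr ++ [b]) := by
  rw [← ofReal_exp_value hβ (partition_ne_top hβ hR (H - tr.length) tr (by omega)),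
    ← ofReal_exp_value hβ (partition_ne_top hβ hR (H - tr.length - 1) (tr ++ [b])
      (by simp; omega)), ← ENNReal.ofReal_mul (Real.exp_pos _).le, ← Real.exp_add, prm]
  congr 2
  ring

theorem expect_exp_prm (hβ : 0 < β) {R : ℝ} (hR : HasRange (prm π H β r) H R) {tr : List B}
    (h : tr.length < H) :
    (expect (π x tr) fun b => ENNReal.ofReal (Real.exp (β * prm π H β r x tr b))) = 1 := by
  have hfin := partition_ne_top (x := x) hβ hR (H - tr.length) tr (by omega)
  have h1 : (expect (π x tr) fun b => ENNReal.ofReal (Real.exp (β * prm π H β r x tr b))) *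
      partition π H β r x tr = 1 * partition π H β r x tr := by
    rw [one_mul]
    conv_rhs => rw [partition_of_length_lt h]
    rw [mul_comm, ← expect_const_mul]
    refine congrArg _ (funext fun b => ?_)
    rw [mul_comm, ofReal_exp_prm_mul hβ hR h]
  exact (ENNReal.mul_left_inj (partition_ne_zero tr) hfin).1 h1

theorem exists_tilted_policy (hβ : 0 < β) {R : ℝ} (hR : HasRange (prm π H β r) H R) :
    ∃ q : Policy X B, ∀ x tr, tr.length < H → ∀ b,
      q x tr b = π x tr b * ENNReal.ofReal (Real.exp (β * prm π H β r x tr b)) := by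
  have h : ∀ x tr, ∃ p : PMF B, tr.length < H → ∀ b,
      p b = π x tr b * ENNReal.ofReal (Real.exp (β * prm π H β r x tr b)) := by
    intro x tr
    by_cases h : tr.length < H
    · refine ⟨⟨fun b => π x tr b * ENNReal.ofReal (Real.exp (β * prm π H β r x tr b)), ?_⟩,
        fun _ b => rfl⟩
      have hsum := expect_exp_prm (x := x) hβ hR h
      rw [expect] at hsum
      rw [← hsum]
      exact ENNReal.summable.hasSum
    -- Past the horizon the policy is arbitrary.
    · exact ⟨π x tr, fun h' => absurd h' h⟩
  choose q hq using h
  exact ⟨q, hq⟩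

/-- Telescoping: each tilted step multiplies by the ratio of the next partition function to the
current one. -/
theorem complete_mul_partition (hβ : 0 < β) {R : ℝ} (hR : HasRange (prm π H β r) H R)
    {q : Policy X B} (hq : ∀ x tr, tr.length < H → ∀ b,
      q x tr b = π x tr b * ENNReal.ofReal (Real.exp (β * prm π H β r x tr b)))
    (k : ℕ) (tr : List B) (hk : tr.length + k = H) (y : List B) :
    complete q x k tr y * partition π H β r x tr =
      complete π x k tr y * ENNReal.ofReal (Real.exp (β * r x y)) := by
  classical
  induction k generalizing tr with
  | zero =>
    rw [complete, complete, partition_of_length_eq (by simpa using hk), PMF.pure_apply]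
    split_ifs with h
    · rw [h]
    · simp
  | succ k ih =>
    have hlt : tr.length < H := by omega
    simp only [complete, PMF.bind_apply, ← ENNReal.tsum_mul_right]
    refine tsum_congr fun b => ?_
    rw [mul_assoc (π x tr b), ← ih (tr ++ [b]) (by simp; omega), hq x tr hlt,
      ← ofReal_exp_prm_mul hβ hR hlt]
    ring

theorem optimalLaw_eq [Countable B] (hβ : 0 < β) {R : ℝ} (hR : HasRange (prm π H β r) H R)
    {q : Policy X B} (hq : ∀ x tr, tr.length < H → ∀ b,
      q x tr b = π x tr b * ENNReal.ofReal (Real.exp (β * prm π H β r x tr b))) :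
    optimalLaw π H β r x = (responseLaw q H x).toMeasure := by
  have hsing : ∀ (p : PMF (List B)) (a : List B), p.toMeasure {a} = p a := fun p a =>
    p.toMeasure_apply_singleton a trivial
  have : DiscreteMeasurableSpace (List B) := ⟨fun _ => trivial⟩
  have hfin := partition_ne_top (x := x) hβ hR H [] (by simp)
  have hlint : (∫⁻ y, ENNReal.ofReal (Real.exp (β * r x y)) ∂(responseLaw π H x).toMeasure) =
      partition π H β r x [] := by
    rw [lintegral_countable', partition, expect]
    refine tsum_congr fun y => ?_
    rw [hsing, mul_comm, responseLaw]
    rfl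
  have hint : ∫ y, Real.exp (β * r x y) ∂(responseLaw π H x).toMeasure =
      (partition π H β r x []).toReal := by
    rw [integral_eq_lintegral_of_nonneg_ae (Filter.Eventually.of_forall fun y => (Real.exp_pos _).le)
      Measurable.of_discrete.aestronglyMeasurable, hlint]
  have hpos := ENNReal.toReal_pos (partition_ne_zero (π := π) (H := H) (β := β) (r := r) (x := x) [])
    hfin
  refine Measure.ext_of_singleton fun y => ?_
  rw [optimalLaw, tilted_apply, Measure.restrict_singleton, lintegral_smul_measure,
    lintegral_dirac, hsing, hsing, smul_eq_mul, hint, ENNReal.ofReal_div_of_pos hpos,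
    ENNReal.ofReal_toReal hfin, ← mul_div_assoc]
  refine ((ENNReal.eq_div_iff (partition_ne_zero _) hfin).2 ?_).symm
  rw [mul_comm]
  exact complete_mul_partition hβ hR hq H [] (by simp) y

end Optimal

/-! ### Coverage -/

section Coverage

variable {X B : Type*}

/-- Otherwise `p` would be dominated by a multiple of `g` of mass below one. -/
theorem one_le_iSup_div (p g : PMF B) : 1 ≤ ⨆ b, p b / g b := by
  by_contra! h
  have hle : ∀ b, p b ≤ (⨆ b, p b / g b) * g b := fun b => by
    have hb : p b / g b ≤ ⨆ b, p b / g b := le_iSup (fun b => p b / g b) b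
    by_cases hg : g b = 0
    · by_cases hp : p b = 0
      · simp [hp]
      · rw [hg, ENNReal.div_zero hp] at hb
        exact absurd (hb.trans_lt h) (by simp)
    · exact (ENNReal.div_le_iff hg (g.apply_ne_top b)).1 hb
  have := ENNReal.tsum_le_tsum hle
  rw [ENNReal.tsum_mul_left, p.tsum_coe, g.tsum_coe, mul_one] at this
  exact absurd h (not_lt.2 this)

theorem one_le_blockCoverage {target draft : Policy X B} {H : ℕ} {x : X} {tr : List B}
    (h : tr.length < H) : 1 ≤ blockCoverage target draft H x := by
  refine le_trans ?_ (le_iSup₂ (f := fun (tr : List B) (_ : tr.length < H) =>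
    (⨆ b : B, target x tr b / draft x tr b) * (⨆ b : B, draft x tr b / target x tr b)) tr h)
  exact one_le_mul (one_le_iSup_div _ _) (one_le_iSup_div _ _)

/-- Both suprema in the coverage are at least one, so their product dominates each; this also covers
the target as its own generator. -/
theorem div_le_blockCoverage {target draft : Policy X B} {H : ℕ} {x : X} {tr : List B}
    (h : tr.length < H) (gen : Generator) (b : B) :
    target x tr b / gen.policy target draft x tr b ≤ blockCoverage target draft H x ∧
      gen.policy target draft x tr b / target x tr b ≤ blockCoverage target draft H x := by
  cases gen with
  | target =>
    exact ⟨ENNReal.div_self_le_one.trans (one_le_blockCoverage h),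
      ENNReal.div_self_le_one.trans (one_le_blockCoverage h)⟩
  | draft =>
    have hle := le_iSup₂ (f := fun (tr : List B) (_ : tr.length < H) =>
      (⨆ b : B, target x tr b / draft x tr b) * (⨆ b : B, draft x tr b / target x tr b)) tr h
    constructor
    · refine le_trans ?_ hle
      exact (le_iSup (fun b => target x tr b / draft x tr b) b).trans
        (le_mul_of_one_le_right zero_le (one_le_iSup_div _ _))
    · refine le_trans ?_ hle
      exact (le_iSup (fun b => draft x tr b / target x tr b) b).trans
        (le_mul_of_one_le_left zero_le (one_le_iSup_div _ _))

/-- If the exponentials of a score with range `R` have mean one, they lie in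
`[exp (-R), exp R]`. -/
theorem abs_le_of_expect_exp {p : PMF B} {f : B → ℝ} {lo R : ℝ} (h1 : ∀ b, lo ≤ f b)
    (h2 : ∀ b, f b ≤ lo + R) (hmean : (expect p fun b => ENNReal.ofReal (Real.exp (f b))) = 1)
    (b : B) : -R ≤ f b ∧ f b ≤ R := by
  have h3 : lo ≤ 0 := by
    have : (expect p fun _ => ENNReal.ofReal (Real.exp lo)) ≤ 1 := by
      rw [← hmean]
      exact expect_mono_of_support fun b _ =>
        ENNReal.ofReal_le_ofReal (Real.exp_le_exp.2 (h1 b))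
    rwa [expect_const, ENNReal.ofReal_le_one, Real.exp_le_one_iff] at this
  have h4 : 0 ≤ lo + R := by
    have : 1 ≤ (expect p fun _ => ENNReal.ofReal (Real.exp (lo + R))) := by
      rw [← hmean]
      exact expect_mono_of_support fun b _ =>
        ENNReal.ofReal_le_ofReal (Real.exp_le_exp.2 (h2 b))
    rwa [expect_const, ENNReal.one_le_ofReal, Real.one_le_exp_iff] at this
  constructor <;> linarith [h1 b, h2 b]

theorem expScore_bounds {p g : PMF B} {β : ℝ} {s : B → ℝ} {C R : ℝ} (hC : 1 ≤ C)
    (h1 : ∀ b, p b / g b ≤ ENNReal.ofReal C) (h2 : ∀ b, g b / p b ≤ ENNReal.ofReal C)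
    (h3 : ∀ b, -R ≤ β * s b ∧ β * s b ≤ R) (b : B) (hb : b ∈ g.support) :
    ENNReal.ofReal (C * Real.exp R)⁻¹ ≤ expScore p g β s b ∧
      expScore p g β s b ≤ ENNReal.ofReal (C * Real.exp R) := by
  have hC0 : 0 < C := by linarith
  have hg : g b ≠ 0 := (PMF.mem_support_iff _ _).1 hb
  have hp : p b ≠ 0 := fun h0 => by
    have := h2 b
    rw [h0, ENNReal.div_zero hg] at this
    exact absurd this (by simp)
  constructor
  · rw [expScore, mul_inv, ENNReal.ofReal_mul (by positivity), ← Real.exp_neg,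
      ENNReal.ofReal_inv_of_pos hC0]
    gcongr
    · rw [ENNReal.inv_le_iff_inv_le, ENNReal.inv_div (Or.inl (g.apply_ne_top b)) (Or.inl hg)]
      exact h2 b
    · exact (h3 b).1
  · rw [expScore, ENNReal.ofReal_mul hC0.le]
    gcongr
    · exact h1 b
    · exact (h3 b).2

end Coverage

/-! ### The bound at one prompt -/

section Prompt

variable {X B : Type*} [Countable B]

theorem klDiv_specsLaw_le (target draft : Policy X B) (r : X → List B → ℝ) (H : ℕ) (β R τ : ℝ)
    (n : ℕ) (hn : 3 ≤ n) (hn0 : 0 < n) (hβ : 0 < β) (hR : HasRange (prm target H β r) H R) (x : X) :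
    InformationTheory.klDiv
        (specsLaw target draft H β (prm target H β r) τ (poissonBeam n hn0) x).toMeasure
        (optimalLaw target H β r x) ≤
      ENNReal.ofReal (entropyConst * Real.log n ^ 1 *
          (H * Real.exp (2 * β * R) / (n : ℝ) ^ (3 / 2 : ℝ))) *
        blockCoverage target draft H x ^ 2 := by
  obtain ⟨q, hq⟩ := exists_tilted_policy hβ hR
  have : DiscreteMeasurableSpace (List B) := ⟨fun _ => trivial⟩
  rw [optimalLaw_eq hβ hR hq]
  have hlog : 0 < Real.log n := Real.log_pos (by exact_mod_cast (by omega : 1 < n))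
  have hconst : 0 < entropyConst := by unfold entropyConst; positivity
  have hstep : ∀ (tr : List B) (gen : Generator), tr.length < H →
      EntropyLe (blockLaw (gen.policy target draft x tr)
        (expScore (target x tr) (gen.policy target draft x tr) β (prm target H β r x tr))
          (poissonBeam n hn0)) (q x tr)
        (ENNReal.ofReal (entropyConst * Real.log n *
          (Real.exp (2 * β * R) / (n : ℝ) ^ (3 / 2 : ℝ))) * blockCoverage target draft H x ^ 2) := by
    intro tr gen htr
    -- With infinite coverage the bound is infinite, as its other factor is positive.
    by_cases hCtop : blockCoverage target draft H x = ∞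
    · have hne : ENNReal.ofReal (entropyConst * Real.log n *
          (Real.exp (2 * β * R) / (n : ℝ) ^ (3 / 2 : ℝ))) ≠ 0 := by
        rw [Ne, ENNReal.ofReal_eq_zero, not_le]
        positivity
      intro u L _ _ _
      rw [hCtop, ENNReal.top_pow two_ne_zero, ENNReal.mul_top hne, top_add]
      exact le_top
    obtain ⟨base, hbase⟩ := hR
    have hC1 := one_le_blockCoverage (target := target) (draft := draft) (x := x) htr
    have hC := ENNReal.ofReal_toReal hCtop
    have hC1' : 1 ≤ (blockCoverage target draft H x).toReal := by
      rw [← ENNReal.one_le_ofReal, hC]; exact hC1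
    have hβs := abs_le_of_expect_exp (p := target x tr) (f := fun b => β * prm target H β r x tr b)
      (lo := β * base x tr) (R := β * R)
      (fun b => mul_le_mul_of_nonneg_left (hbase x tr htr b).1 hβ.le)
      (fun b => by
        rw [← mul_add]
        exact mul_le_mul_of_nonneg_left (hbase x tr htr b).2 hβ.le)
      (expect_exp_prm hβ ⟨base, hbase⟩ htr)
    have hR0 : 0 ≤ β * R := by
      obtain ⟨b, _⟩ := (target x tr).support_nonempty
      linarith [(hβs b).1, (hβs b).2]
    have hw := expScore_bounds (p := target x tr) (g := gen.policy target draft x tr) hC1'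
      (fun b => by rw [hC]; exact (div_le_blockCoverage htr gen b).1)
      (fun b => by rw [hC]; exact (div_le_blockCoverage htr gen b).2) hβs
    have hQ : ∀ b, q x tr b = gen.policy target draft x tr b *
        expScore (target x tr) (gen.policy target draft x tr) β (prm target H β r x tr) b := by
      intro b
      rw [hq x tr htr, expScore, ← mul_assoc]
      congr 1
      -- Finite coverage forces the target to vanish wherever the generator does, so no mass of `q`
      -- is lost.
      by_cases hg : gen.policy target draft x tr b = 0
      · have := (div_le_blockCoverage (draft := draft) (target := target) (x := x) htr gen b).1
        rw [hg] at this ⊢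
        by_contra hp
        rw [zero_mul] at hp
        rw [ENNReal.div_zero hp] at this
        exact hCtop (top_le_iff.1 this)
      · rw [ENNReal.mul_div_cancel hg (PMF.apply_ne_top _ _)]
    have hM : 1 ≤ (blockCoverage target draft H x).toReal * Real.exp (β * R) :=
      one_le_mul_of_one_le_of_one_le hC1' (Real.one_le_exp hR0)
    have hmain := entropyLe_blockLaw_of_weight hM hQ hw hn hn0
    have hK : ENNReal.ofReal (entropyConst * Real.log n *
        (((blockCoverage target draft H x).toReal * Real.exp (β * R)) ^ 2 /
          (n : ℝ) ^ (3 / 2 : ℝ))) = ENNReal.ofReal (entropyConst * Real.log n *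
          (Real.exp (2 * β * R) / (n : ℝ) ^ (3 / 2 : ℝ))) * blockCoverage target draft H x ^ 2 := by
      conv_rhs => rw [← hC]
      rw [← ENNReal.ofReal_pow ENNReal.toReal_nonneg, ← ENNReal.ofReal_mul (by positivity)]
      congr 1
      rw [mul_pow, ← Real.exp_nat_mul]
      push_cast
      rw [← mul_assoc 2 β R]
      ring
    rwa [hK] at hmain
  refine (entropyLe_run (τ := τ) hstep H [] Generator.target (by simp)).klDiv_le.trans_eq ?_
  rw [← mul_assoc, ← ENNReal.ofReal_natCast H, ← ENNReal.ofReal_mul (by positivity)]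
  congr 2
  ring

end Prompt

end

end SPECS

theorem mainTheorem1 :
    ∃ (c : ℝ) (k : ℕ), 0 < c ∧
      ∀ (X B : Type*) [Countable B] (target draft : SPECS.Policy X B) (r : X → List B → ℝ)
        (H : ℕ) (β R τ : ℝ) (n : ℕ) (hn : 3 ≤ n), 0 < β →
        SPECS.HasRange (SPECS.prm target H β r) H R →
        (∀ x : X,
          InformationTheory.klDiv
              (SPECS.specsLaw target draft H β (SPECS.prm target H β r) τ
                (SPECS.poissonBeam n (by omega)) x).toMeasure
              (SPECS.optimalLaw target H β r x) ≤
            ENNReal.ofReal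
                (c * Real.log n ^ k * (H * Real.exp (2 * β * R) / (n : ℝ) ^ (3 / 2 : ℝ))) *
              SPECS.blockCoverage target draft H x ^ 2) ∧
        ∀ ρ : PMF X,
          ∑' x : X, ρ x *
              InformationTheory.klDiv
                (SPECS.specsLaw target draft H β (SPECS.prm target H β r) τ
                  (SPECS.poissonBeam n (by omega)) x).toMeasure
                (SPECS.optimalLaw target H β r x) ≤
            ENNReal.ofReal
                (c * Real.log n ^ k * (H * Real.exp (2 * β * R) / (n : ℝ) ^ (3 / 2 : ℝ))) *
              (⨆ x : X, SPECS.blockCoverage target draft H x) ^ 2 := by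
  refine ⟨SPECS.entropyConst, 1, by unfold SPECS.entropyConst; positivity, ?_⟩
  intro X B _ target draft r H β R τ n hn hβ hR
  have hx := SPECS.klDiv_specsLaw_le target draft r H β R τ n hn (by omega) hβ hR
  refine ⟨hx, fun ρ => ?_⟩
  refine (SPECS.expect_mono_of_support (p := ρ) fun x _ => (hx x).trans ?_).trans_eq
    (SPECS.expect_const ρ _)
  gcongr
  exact le_iSup (fun x => SPECS.blockCoverage target draft H x) x
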